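/- Theorem (risk-neutral measure). Let $T>0$ and let $\mu_1,\mu_2,\lambda_1,\lambda_2>0$ be real constants. Let $(\Omega,\mathcal F,\mathbb P)$ be a probability space carrying two independent Poisson processes $N^1=(N^1_t)_{t\in[0,T]}$ and $N^2=(N^2_t)_{t\in[0,T]}$ with respective intensities $\mu_1,\mu_2$, and let $(\mathcal F_t)_{t\in[0,T]}$ be the filtration generated by these two processes. Consider the asset prices $$B_t=1,\qquad S^1_t=N^1_t+\lambda_1(T-t),\qquad S^2_t=N^2_t+\lambda_2(T-t),\qquad t\in[0,T].$$ Then there exists a probability measure $\mathbb Q$ on $(\Omega,\mathcal F)$ such that: (a) $B$, $S^1$ and $S^2$ are $\mathbb Q$-martingales with respect to $(\mathcal F_t)_{t\in[0,T]}$; (b) under $\mathbb Q$, $N^1$ and $N^2$ are (independent) Poisson processes with intensities $\lambda_1$ and $\lambda_2$, respectively; (c) $\mathbb Q$ is equivalent to $\mathbb P$, that is, $\mathbb Q$ and $\mathbb P$ have the same null sets; (d) $\mathbb Q$ is the unique equivalent martingale measure on $\mathcal F_T$: if $\mathbb Q'$ is any probability measure on $(\Omega,\mathcal F)$ which has the same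 null sets in $\mathcal F_T$ as $\mathbb P$ and under which $B$, $S^1$ and $S^2$ are martingales with respect to $(\mathcal F_t)_{t\in[0,T]}$, then $\mathbb Q'(A)=\mathbb Q(A)$ for every $A\in\mathcal F_T$. -/

import Mathlib

open MeasureTheory ProbabilityTheory

/-- `N` is a (homogeneous) Poisson process with intensity `r` on the time interval `[0, T]` under
the measure `P`: a counting process (started at `0`, with nondecreasing right-continuous paths,
almost surely) with independent increments, whose increment over `[s, t]` has the Poisson law with
parameter `r * (t - s)`. Increments are formed in `ℝ`, so that no natural-number subtraction
occurs. -/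
structure IsPoissonProcess {Ω : Type*} [MeasurableSpace Ω] {T : ℝ}
    (N : Set.Icc (0 : ℝ) T → Ω → ℕ) (r : ℝ) (P : Measure Ω) : Prop where
  measurable : ∀ t, Measurable (N t)
  start_zero : ∀ t : Set.Icc (0 : ℝ) T, (t : ℝ) = 0 → ∀ᵐ ω ∂P, N t ω = 0
  monotone_paths : ∀ᵐ ω ∂P, Monotone fun t => N t ω
  rightContinuous_paths :
    ∀ᵐ ω ∂P, ∀ t, ContinuousWithinAt (fun s => N s ω) (Set.Ici t) t
  indep_increments : HasIndepIncrements (fun t ω => (N t ω : ℝ)) P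
  law_increments : ∀ s t : Set.Icc (0 : ℝ) T, s ≤ t →
    HasLaw (fun ω => (N t ω : ℝ) - (N s ω : ℝ))
      ((poissonMeasure (r * ((t : ℝ) - (s : ℝ))).toNNReal).map (Nat.cast : ℕ → ℝ)) P

/-- The filtration on `[0, T]` generated by the two goal processes: the `σ`-algebra at time `t` is
generated by `N₁ s` and `N₂ s` for `s ≤ t`. -/
noncomputable def goalFiltration {Ω : Type*} [mΩ : MeasurableSpace Ω] {T : ℝ}
    (N₁ N₂ : Set.Icc (0 : ℝ) T → Ω → ℕ)
    (h₁ : ∀ t, Measurable (N₁ t)) (h₂ : ∀ t, Measurable (N₂ t)) :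
    Filtration (Set.Icc (0 : ℝ) T) mΩ :=
  Filtration.natural (fun t ω => (N₁ t ω, N₂ t ω))
    fun t => ((h₁ t).prodMk (h₂ t)).stronglyMeasurable

/-- The bond price `B_t = 1`. -/
def bondPrice {Ω : Type*} {T : ℝ} : Set.Icc (0 : ℝ) T → Ω → ℝ :=
  fun _ _ => 1

/-- The asset price `S_t = N_t + lam * (T - t)` of the asset that pays the number of goals counted
by `N` at time `T`. -/
def assetPrice {Ω : Type*} {T : ℝ} (N : Set.Icc (0 : ℝ) T → Ω → ℕ) (lam : ℝ) :
    Set.Icc (0 : ℝ) T → Ω → ℝ :=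
  fun t ω => (N t ω : ℝ) + lam * (T - (t : ℝ))

/-- All three asset price processes are martingales under `Q` with respect to `ℱ`. -/
def IsMartingaleMeasure {Ω : Type*} [mΩ : MeasurableSpace Ω] {T : ℝ}
    (ℱ : Filtration (Set.Icc (0 : ℝ) T) mΩ) (N₁ N₂ : Set.Icc (0 : ℝ) T → Ω → ℕ)
    (lam₁ lam₂ : ℝ) (Q : Measure Ω) : Prop :=
  Martingale bondPrice ℱ Q ∧ Martingale (assetPrice N₁ lam₁) ℱ Q ∧
    Martingale (assetPrice N₂ lam₂) ℱ Q

open Filter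
open scoped ENNReal NNReal Topology

/-! Existence. The density `exp (log (lam / mu) * N_T - (lam - mu) * T)` is the likelihood ratio of
two Poisson laws. Its exponent is additive over increments, so along every partition of `[0, T]` it
is a product of functions of single increments: these stay independent, and each Poisson law is
tilted from rate `mu` to rate `lam` (`IsPoissonProcess.withDensity`). Since the density depends on
one process only, it changes neither the law of an independent second process nor the independence
(`IsPoissonProcess.pair_withDensity`), and the two intensities can be changed one after the other.
Positivity of the densities gives equivalence. The prices are martingales because an increment is
independent of the joint past and has mean `lam * (t - s)`.

Uniqueness is Watanabe's argument. Almost surely under `P`, every interval of a fine enough dyadic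
grid contains at most one goal of the two teams together, and this passes to any measure with the
same null sets in the terminal `σ`-algebra. On such an interval the ratio of consecutive values of
`exp (i (θ N₁ + η N₂))` is exactly affine in the increments of `N₁` and `N₂`, whose conditional
means are prescribed by the martingale property. Each step of length `d` thus multiplies the
expectation by `1 + d * poissonExponent`, up to an error from multiple goals that vanishes in the
limit, and the product tends to an exponential (`integral_mul_goalChar_of_martingale`). All
finite-dimensional characteristic functions are then determined, hence so is the law of the path. -/

/-! ### Product densities over independent variables, and the tilted Poisson law -/

/-- The indicators of the events are absorbed into the factors, so independence splits the integral;
the factors outside `S` integrate to one. Both the new marginals and the preserved independence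
follow from this formula. -/
theorem withDensity_prod_measure_biInter {Ω ι E : Type*} [MeasurableSpace Ω] [MeasurableSpace E]
    [Fintype ι] {P : Measure Ω} {X : ι → Ω → E} (hX : iIndepFun X P)
    (hm : ∀ i, Measurable (X i)) {g : ι → E → ℝ≥0∞} (hg : ∀ i, Measurable (g i))
    (h1 : ∀ i, ∫⁻ ω, g i (X i ω) ∂P = 1) (S : Finset ι) {B : ι → Set E}
    (hB : ∀ i, MeasurableSet (B i)) :
    (P.withDensity fun ω => ∏ i, g i (X i ω)) (⋂ i ∈ S, X i ⁻¹' B i) =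
      ∏ i ∈ S, ∫⁻ ω in X i ⁻¹' B i, g i (X i ω) ∂P := by
  classical
  let f : ι → E → ℝ≥0∞ := fun i => if i ∈ S then (B i).indicator (g i) else g i
  have hf : ∀ i, Measurable (f i) := fun i => by
    by_cases hi : i ∈ S
    · simpa [f, hi] using (hg i).indicator (hB i)
    · simpa [f, hi] using hg i
  have hS : MeasurableSet (⋂ i ∈ S, X i ⁻¹' B i) :=
    S.measurableSet_biInter fun i _ => hm i (hB i)
  have hprod : (⋂ i ∈ S, X i ⁻¹' B i).indicator (fun ω => ∏ i, g i (X i ω)) =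
      fun ω => ∏ i, f i (X i ω) := by
    funext ω
    by_cases hω : ω ∈ ⋂ i ∈ S, X i ⁻¹' B i
    · rw [Set.indicator_of_mem hω]
      refine Finset.prod_congr rfl fun i _ => ?_
      by_cases hi : i ∈ S
      · have : X i ω ∈ B i := by simpa using Set.mem_iInter₂.1 hω i hi
        simp [f, hi, this]
      · simp [f, hi]
    · rw [Set.indicator_of_notMem hω]
      obtain ⟨i, hi, hiω⟩ : ∃ i ∈ S, X i ω ∉ B i := by simpa using hω
      exact (Finset.prod_eq_zero (Finset.mem_univ i) (by simp [f, hi, hiω])).symm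
  rw [withDensity_apply _ hS, ← lintegral_indicator hS, hprod,
    lintegral_prod_eq_prod_lintegral_of_indepFun Finset.univ (fun i ω => f i (X i ω))
      (hX.comp f hf) fun i => (hf i).comp (hm i),
    ← Finset.prod_subset (Finset.subset_univ S)]
  · refine Finset.prod_congr rfl fun i hi => ?_
    rw [← lintegral_indicator (hm i (hB i))]
    refine lintegral_congr fun ω => ?_
    simp only [f, hi, if_true]
    rfl
  · intro i _ hi
    simpa [f, hi] using h1 i

theorem withDensity_prod_map {Ω ι E : Type*} [MeasurableSpace Ω] [MeasurableSpace E]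
    [Fintype ι] {P : Measure Ω} {X : ι → Ω → E} (hX : iIndepFun X P)
    (hm : ∀ i, Measurable (X i)) {g : ι → E → ℝ≥0∞} (hg : ∀ i, Measurable (g i))
    (h1 : ∀ i, ∫⁻ ω, g i (X i ω) ∂P = 1) (i : ι) :
    (P.withDensity fun ω => ∏ i, g i (X i ω)).map (X i) = (P.map (X i)).withDensity (g i) := by
  ext B hB
  have := withDensity_prod_measure_biInter hX hm hg h1 {i} (B := fun _ => B) fun _ => hB
  simp only [Finset.mem_singleton, Set.iInter_iInter_eq_left, Finset.prod_singleton] at this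
  rw [Measure.map_apply (hm i) hB, this, withDensity_apply _ hB,
    setLIntegral_map hB (hg i) (hm i)]

theorem iIndepFun_withDensity_prod {Ω ι E : Type*} [MeasurableSpace Ω] [MeasurableSpace E]
    [Fintype ι] {P : Measure Ω} {X : ι → Ω → E} (hX : iIndepFun X P)
    (hm : ∀ i, Measurable (X i)) {g : ι → E → ℝ≥0∞} (hg : ∀ i, Measurable (g i))
    (h1 : ∀ i, ∫⁻ ω, g i (X i ω) ∂P = 1) :
    iIndepFun X (P.withDensity fun ω => ∏ i, g i (X i ω)) := by
  classical
  rw [iIndepFun_iff_measure_inter_preimage_eq_mul]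
  intro S B hB
  let B' : ι → Set E := fun i => if i ∈ S then B i else Set.univ
  have hB' : ∀ i, MeasurableSet (B' i) := fun i => by
    by_cases hi : i ∈ S
    · simpa [B', hi] using hB i hi
    · simp [B', hi]
  have hBB' : ∀ i ∈ S, B i = B' i := fun i hi => by simp [B', hi]
  have hint : (⋂ i ∈ S, X i ⁻¹' B i) = ⋂ i ∈ S, X i ⁻¹' B' i :=
    Set.iInter₂_congr fun i hi => by rw [hBB' i hi]
  rw [hint, withDensity_prod_measure_biInter hX hm hg h1 S hB']
  refine Finset.prod_congr rfl fun i hi => ?_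
  have := withDensity_prod_measure_biInter hX hm hg h1 {i} hB'
  simp only [Finset.mem_singleton, Set.iInter_iInter_eq_left, Finset.prod_singleton] at this
  rw [hBB' i hi, this]

/-- The density at `n` is the ratio `(lam / mu) ^ n * exp (-(lam - mu) * d)` of the two Poisson
weights. -/
theorem poissonMeasure_withDensity_exp {mu lam d : ℝ} (hmu : 0 < mu) (hlam : 0 < lam)
    (hd : 0 ≤ d) :
    ((poissonMeasure (mu * d).toNNReal).map (Nat.cast : ℕ → ℝ)).withDensity
        (fun x => ENNReal.ofReal (Real.exp (Real.log (lam / mu) * x - (lam - mu) * d))) =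
      (poissonMeasure (lam * d).toNNReal).map (Nat.cast : ℕ → ℝ) := by
  set g : ℝ → ℝ≥0∞ :=
    fun x => ENNReal.ofReal (Real.exp (Real.log (lam / mu) * x - (lam - mu) * d)) with hg
  have hgm : Measurable g := by fun_prop
  have key : (poissonMeasure (mu * d).toNNReal).withDensity (fun n => g n) =
      poissonMeasure (lam * d).toNNReal := by
    refine Measure.ext_of_singleton fun n => ?_
    rw [withDensity_apply _ (measurableSet_singleton n), lintegral_singleton,
      poissonMeasure_singleton, poissonMeasure_singleton, hg,
      Real.coe_toNNReal _ (by positivity), Real.coe_toNNReal _ (by positivity),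
      ← ENNReal.ofReal_mul (Real.exp_nonneg _)]
    congr 1
    have h1 : Real.exp (Real.log (lam / mu) * n - (lam - mu) * d) =
        (lam / mu) ^ n * Real.exp (-((lam - mu) * d)) := by
      rw [sub_eq_add_neg, Real.exp_add, mul_comm (Real.log _), Real.exp_nat_mul,
        Real.exp_log (by positivity)]
    have h2 : Real.exp (-(lam * d)) = Real.exp (-((lam - mu) * d)) * Real.exp (-(mu * d)) := by
      rw [← Real.exp_add]; ring_nf
    rw [h1, h2, div_pow, mul_pow, mul_pow]
    field_simp
  ext B hB
  rw [withDensity_apply _ hB, setLIntegral_map hB hgm (by fun_prop), Measure.map_apply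
    (by fun_prop) hB, ← key, withDensity_apply _ (by measurability)]

/-! ### Changing the intensity of one Poisson process -/

section ChangeOfIntensity

variable {Ω : Type*} [MeasurableSpace Ω] {T : ℝ}

/-- The likelihood ratio, on `[0, T]`, of the intensity `lam` against the intensity `mu`. -/
noncomputable def intensityDensity (hT : 0 ≤ T) (N : Set.Icc (0 : ℝ) T → Ω → ℕ) (mu lam : ℝ)
    (ω : Ω) : ℝ≥0∞ :=
  ENNReal.ofReal (Real.exp
    (Real.log (lam / mu) * N ⟨T, hT, le_rfl⟩ ω - (lam - mu) * T))

omit [MeasurableSpace Ω] in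
theorem intensityDensity_pos (hT : 0 ≤ T) (N : Set.Icc (0 : ℝ) T → Ω → ℕ) (mu lam : ℝ) (ω : Ω) :
    0 < intensityDensity hT N mu lam ω :=
  ENNReal.ofReal_pos.2 (Real.exp_pos _)

theorem measurable_intensityDensity (hT : 0 ≤ T) {N : Set.Icc (0 : ℝ) T → Ω → ℕ}
    (hN : ∀ t, Measurable (N t)) (mu lam : ℝ) : Measurable (intensityDensity hT N mu lam) := by
  have := hN ⟨T, hT, le_rfl⟩
  unfold intensityDensity
  fun_prop

variable {N : Set.Icc (0 : ℝ) T → Ω → ℕ} {mu lam : ℝ} {P : Measure Ω}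

theorem IsPoissonProcess.measurable_sub (hN : IsPoissonProcess N mu P) (s t : Set.Icc (0 : ℝ) T) :
    Measurable fun ω => (N t ω : ℝ) - (N s ω : ℝ) := by
  have h1 := hN.measurable s
  have h2 := hN.measurable t
  fun_prop

/-- The exponent is linear in `N_T - N_0` and in `T`, so it telescopes along the partition; the
equality is only almost sure because `N_0 = 0` is. -/
theorem IsPoissonProcess.intensityDensity_ae_eq_prod (hT : 0 ≤ T) (hN : IsPoissonProcess N mu P)
    {τ : ℕ → Set.Icc (0 : ℝ) T} {m : ℕ} (h0 : (τ 0 : ℝ) = 0) (hm : (τ m : ℝ) = T) (lam : ℝ) :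
    intensityDensity hT N mu lam =ᵐ[P] fun ω => ∏ i : Fin m,
      ENNReal.ofReal (Real.exp (Real.log (lam / mu) * ((N (τ (i + 1)) ω : ℝ) - N (τ i) ω) -
        (lam - mu) * ((τ (i + 1) : ℝ) - τ i))) := by
  filter_upwards [hN.start_zero (τ 0) h0] with ω hω
  have hT' : τ m = ⟨T, hT, le_rfl⟩ := Subtype.ext hm
  rw [← ENNReal.ofReal_prod_of_nonneg fun _ _ => Real.exp_nonneg _, ← Real.exp_sum,
    Finset.sum_sub_distrib, ← Finset.mul_sum, ← Finset.mul_sum,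
    Fin.sum_univ_eq_sum_range (fun i => (N (τ (i + 1)) ω : ℝ) - N (τ i) ω),
    Fin.sum_univ_eq_sum_range (fun i => (τ (i + 1) : ℝ) - τ i),
    Finset.sum_range_sub (fun i => (N (τ i) ω : ℝ)), Finset.sum_range_sub (fun i => (τ i : ℝ)),
    h0, hm, hω, hT']
  simp [intensityDensity]

theorem IsPoissonProcess.lintegral_increment_density (hmu : 0 < mu) (hlam : 0 < lam)
    (hN : IsPoissonProcess N mu P) {s t : Set.Icc (0 : ℝ) T} (hst : s ≤ t) :
    ∫⁻ ω, ENNReal.ofReal (Real.exp (Real.log (lam / mu) * ((N t ω : ℝ) - N s ω) -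
        (lam - mu) * ((t : ℝ) - s))) ∂P = 1 := by
  have hd : (0 : ℝ) ≤ (t : ℝ) - s := sub_nonneg.2 hst
  have h := (hN.law_increments s t hst).lintegral_comp
    (f := fun x => ENNReal.ofReal (Real.exp (Real.log (lam / mu) * x -
        (lam - mu) * ((t : ℝ) - s)))) (by fun_prop)
  rw [h, ← setLIntegral_univ, ← withDensity_apply _ MeasurableSet.univ,
    poissonMeasure_withDensity_exp hmu hlam hd, measure_univ]

theorem IsPoissonProcess.lintegral_intensityDensity (hT : 0 ≤ T) (hmu : 0 < mu) (hlam : 0 < lam)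
    (hN : IsPoissonProcess N mu P) : ∫⁻ ω, intensityDensity hT N mu lam ω ∂P = 1 := by
  let τ : ℕ → Set.Icc (0 : ℝ) T := fun n => if n = 0 then ⟨0, le_rfl, hT⟩ else ⟨T, hT, le_rfl⟩
  rw [lintegral_congr_ae (hN.intensityDensity_ae_eq_prod hT (τ := τ) (m := 1) (by simp [τ])
    (by simp [τ]) lam)]
  simp only [Finset.univ_unique, Finset.prod_singleton]
  exact hN.lintegral_increment_density hmu hlam (by simp [τ, hT, ← Subtype.coe_le_coe])

theorem IsPoissonProcess.increments_withDensity (hT : 0 ≤ T) (hmu : 0 < mu) (hlam : 0 < lam)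
    (hN : IsPoissonProcess N mu P) {τ : ℕ → Set.Icc (0 : ℝ) T} (hτ : Monotone τ) {m : ℕ}
    (h0 : (τ 0 : ℝ) = 0) (hm : (τ m : ℝ) = T) :
    iIndepFun (fun (i : Fin m) ω => (N (τ (i + 1)) ω : ℝ) - N (τ i) ω)
        (P.withDensity (intensityDensity hT N mu lam)) ∧
      ∀ i : Fin m, (P.withDensity (intensityDensity hT N mu lam)).map
        (fun ω => (N (τ (i + 1)) ω : ℝ) - N (τ i) ω) =
        (poissonMeasure (lam * ((τ (i + 1) : ℝ) - τ i)).toNNReal).map (Nat.cast : ℕ → ℝ) := by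
  have hind : iIndepFun (fun (i : Fin m) ω => (N (τ (i + 1)) ω : ℝ) - N (τ i) ω) P :=
    (hN.indep_increments.nat hτ).precomp Fin.val_injective
  have hle : ∀ i : ℕ, τ i ≤ τ (i + 1) := fun i => hτ (Nat.le_succ i)
  rw [withDensity_congr_ae (hN.intensityDensity_ae_eq_prod hT h0 hm lam)]
  have hmX : ∀ i : Fin m, Measurable fun ω => (N (τ (i + 1)) ω : ℝ) - N (τ i) ω :=
    fun i => hN.measurable_sub _ _
  let g : Fin m → ℝ → ℝ≥0∞ := fun i x => ENNReal.ofReal (Real.exp (Real.log (lam / mu) * x -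
        (lam - mu) * ((τ (i + 1) : ℝ) - τ i)))
  have hg : ∀ i, Measurable (g i) := fun i => by
    change Measurable fun x => ENNReal.ofReal (Real.exp (_ * x - _))
    fun_prop
  have h1 : ∀ i : Fin m, ∫⁻ ω, g i ((N (τ (i + 1)) ω : ℝ) - N (τ i) ω) ∂P = 1 :=
    fun i => hN.lintegral_increment_density hmu hlam (hle i)
  have h2 := iIndepFun_withDensity_prod hind hmX hg h1
  have h3 := withDensity_prod_map hind hmX hg h1
  refine ⟨h2, fun i => ?_⟩
  have h4 := poissonMeasure_withDensity_exp hmu hlam (sub_nonneg.2 (hle i))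
  have h5 := h3 i
  rw [(hN.law_increments _ _ (hle i)).map_eq] at h5
  exact h5.trans h4

theorem IsPoissonProcess.withDensity (hT : 0 ≤ T) (hmu : 0 < mu) (hlam : 0 < lam)
    (hN : IsPoissonProcess N mu P) :
    IsPoissonProcess N lam (P.withDensity (intensityDensity hT N mu lam)) where
  measurable := hN.measurable
  start_zero t ht := (withDensity_absolutelyContinuous _ _).ae_le (hN.start_zero t ht)
  monotone_paths := (withDensity_absolutelyContinuous _ _).ae_le hN.monotone_paths
  rightContinuous_paths := (withDensity_absolutelyContinuous _ _).ae_le hN.rightContinuous_paths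
  indep_increments := by
    intro n t ht
    -- The density factors only over partitions of the whole interval, so the given times are
    -- shifted to the positions `1, ..., n + 1` and padded with `0` before and `T` after.
    let τ : ℕ → Set.Icc (0 : ℝ) T := fun k =>
      if k = 0 then ⟨0, le_rfl, hT⟩ else if h : k < n + 2 then t ⟨k - 1, by omega⟩
        else ⟨T, hT, le_rfl⟩
    have hτ : Monotone τ := by
      intro a b hab
      simp only [τ]
      split_ifs with h1 h2 h3 h4 h5 h6 h7 h8
      all_goals first
        | exact le_rfl
        | (exfalso; omega)
        | exact (t _).2.1
        | exact hT
        | exact (t _).2.2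
        | exact ht (by simp only [Fin.mk_le_mk]; omega)
    have h := (hN.increments_withDensity hT hmu hlam hτ (m := n + 2) (by simp [τ])
      (by simp [τ])).1
    have hinj : Function.Injective fun i : Fin n => (⟨i + 1, by omega⟩ : Fin (n + 2)) := by
      intro i j hij
      simpa [Fin.ext_iff] using hij
    have h' := h.precomp hinj
    convert h' using 3 with i ω
    have e1 : τ (i + 1 + 1) = t i.succ := by
      simp only [τ]
      rw [if_neg (by omega), dif_pos (by omega)]
      rfl
    have e2 : τ (i + 1) = t i.castSucc := by
      simp only [τ]
      rw [if_neg (by omega), dif_pos (by omega)]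
      rfl
    simp [e1, e2]
  law_increments := by
    intro s t hst
    -- The partition `0, s, t, T`; the increment wanted is the one with index `1`.
    let τ : ℕ → Set.Icc (0 : ℝ) T := fun k =>
      if k = 0 then ⟨0, le_rfl, hT⟩ else if k = 1 then s else if k = 2 then t
        else ⟨T, hT, le_rfl⟩
    have hτ : Monotone τ := by
      refine monotone_nat_of_le_succ fun k => ?_
      simp only [τ]
      split_ifs
      all_goals first
        | exact le_rfl
        | (exfalso; omega)
        | exact s.2.1
        | exact hst
        | exact t.2.2
    have h := (hN.increments_withDensity hT hmu hlam hτ (m := 3) (by simp [τ])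
      (by simp [τ])).2 1
    refine ⟨(hN.measurable_sub s t).aemeasurable, ?_⟩
    simpa [τ] using h

end ChangeOfIntensity

/-! ### Changing both intensities of an independent pair -/

theorem withDensity_comp_preimage_of_indepFun {Ω α β : Type*} [MeasurableSpace Ω]
    [MeasurableSpace α] [MeasurableSpace β] {P : Measure Ω} {X : Ω → α} {Y : Ω → β}
    (hX : Measurable X) (hY : Measurable Y) (h : IndepFun X Y P) {g : β → ℝ≥0∞}
    (hg : Measurable g) {A : Set α} {B : Set β} (hA : MeasurableSet A) (hB : MeasurableSet B) :
    (P.withDensity fun ω => g (Y ω)) (X ⁻¹' A ∩ Y ⁻¹' B) =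
      P (X ⁻¹' A) * (P.withDensity fun ω => g (Y ω)) (Y ⁻¹' B) := by
  have hAB : MeasurableSet (X ⁻¹' A ∩ Y ⁻¹' B) := (hX hA).inter (hY hB)
  have hprod : (X ⁻¹' A ∩ Y ⁻¹' B).indicator (fun ω => g (Y ω)) =
      (fun ω => A.indicator 1 (X ω)) * fun ω => B.indicator g (Y ω) := by
    funext ω
    by_cases h1 : X ω ∈ A <;> by_cases h2 : Y ω ∈ B <;> simp [Set.indicator, h1, h2]
  have h' : IndepFun (fun ω => A.indicator (1 : α → ℝ≥0∞) (X ω))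
      (fun ω => B.indicator g (Y ω)) P :=
    h.comp (measurable_one.indicator hA) (hg.indicator hB)
  rw [withDensity_apply _ hAB, ← lintegral_indicator hAB, hprod,
    lintegral_mul_eq_lintegral_mul_lintegral_of_indepFun
      (f := fun ω => A.indicator (1 : α → ℝ≥0∞) (X ω)) (g := fun ω => B.indicator g (Y ω))
      ((measurable_one.indicator hA).comp hX) ((hg.indicator hB).comp hY) h',
    withDensity_apply _ (hY hB), ← lintegral_indicator (hY hB)]
  congr 1
  exact lintegral_indicator_one (hX hA)

theorem withDensity_comp_preimage_left {Ω α β : Type*} [MeasurableSpace Ω]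
    [MeasurableSpace α] [MeasurableSpace β] {P : Measure Ω} {X : Ω → α} {Y : Ω → β}
    (hX : Measurable X) (hY : Measurable Y) (h : IndepFun X Y P) {g : β → ℝ≥0∞}
    (hg : Measurable g) (h1 : ∫⁻ ω, g (Y ω) ∂P = 1) {A : Set α} (hA : MeasurableSet A) :
    (P.withDensity fun ω => g (Y ω)) (X ⁻¹' A) = P (X ⁻¹' A) := by
  have := withDensity_comp_preimage_of_indepFun hX hY h hg hA MeasurableSet.univ
  simpa [withDensity_apply _ MeasurableSet.univ, h1] using this

theorem indepFun_withDensity_comp {Ω α β : Type*} [MeasurableSpace Ω]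
    [MeasurableSpace α] [MeasurableSpace β] {P : Measure Ω} {X : Ω → α} {Y : Ω → β}
    (hX : Measurable X) (hY : Measurable Y) (h : IndepFun X Y P) {g : β → ℝ≥0∞}
    (hg : Measurable g) (h1 : ∫⁻ ω, g (Y ω) ∂P = 1) :
    IndepFun X Y (P.withDensity fun ω => g (Y ω)) := by
  rw [indepFun_iff_measure_inter_preimage_eq_mul]
  intro A B hA hB
  rw [withDensity_comp_preimage_of_indepFun hX hY h hg hA hB,
    withDensity_comp_preimage_left hX hY h hg h1 hA]

section

variable {Ω : Type*} [MeasurableSpace Ω] {T : ℝ}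
  {N N₁ N₂ : Set.Icc (0 : ℝ) T → Ω → ℕ} {P : Measure Ω}

theorem IsPoissonProcess.measurable_path {r : ℝ} (hN : IsPoissonProcess N r P) :
    Measurable fun ω t => N t ω :=
  measurable_pi_lambda _ hN.measurable

/-- Each defining property is either an almost sure statement, inherited through `R ≪ P`, or a
statement about the law of the path. -/
theorem IsPoissonProcess.of_preimage_path_eq {r : ℝ} {R : Measure Ω}
    (hN : IsPoissonProcess N r P) (hRP : R ≪ P)
    (h : ∀ C : Set (Set.Icc (0 : ℝ) T → ℕ), MeasurableSet C →
      R ((fun ω t => N t ω) ⁻¹' C) = P ((fun ω t => N t ω) ⁻¹' C)) :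
    IsPoissonProcess N r R where
  measurable := hN.measurable
  start_zero t ht := hRP.ae_le (hN.start_zero t ht)
  monotone_paths := hRP.ae_le hN.monotone_paths
  rightContinuous_paths := hRP.ae_le hN.rightContinuous_paths
  indep_increments := by
    intro n t ht
    have hi := hN.indep_increments n t ht
    rw [iIndepFun_iff_measure_inter_preimage_eq_mul] at hi ⊢
    intro S B hB
    have hm : ∀ i : Fin n, Measurable fun f : Set.Icc (0 : ℝ) T → ℕ =>
        (f (t i.succ) : ℝ) - f (t i.castSucc) := fun i => by fun_prop
    have h1 := h _ (S.measurableSet_biInter fun i hi' => hm i (hB i hi'))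
    have h2 : ∀ i ∈ S, _ := fun i hi' => h _ (hm i (hB i hi'))
    rw [Set.preimage_iInter₂] at h1
    refine (h1.trans (hi S hB)).trans (Finset.prod_congr rfl fun i hi' => ?_)
    exact (h2 i hi').symm
  law_increments := by
    intro s t hst
    have hl := hN.law_increments s t hst
    have hm : Measurable fun f : Set.Icc (0 : ℝ) T → ℕ => (f t : ℝ) - f s := by fun_prop
    refine ⟨(hN.measurable_sub s t).aemeasurable, ?_⟩
    rw [← hl.map_eq]
    ext B hB
    rw [Measure.map_apply (hN.measurable_sub s t) hB,
      Measure.map_apply (hN.measurable_sub s t) hB]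
    exact h _ (hm hB)

/-- Changing the intensity of one of two independent Poisson processes does not affect the
other one. -/
theorem IsPoissonProcess.pair_withDensity (hT : 0 ≤ T) {r mu lam : ℝ} (hmu : 0 < mu)
    (hlam : 0 < lam) (h₁ : IsPoissonProcess N₁ r P) (h₂ : IsPoissonProcess N₂ mu P)
    (h : IndepFun (fun ω t => N₁ t ω) (fun ω t => N₂ t ω) P) :
    IsPoissonProcess N₁ r (P.withDensity (intensityDensity hT N₂ mu lam)) ∧
      IsPoissonProcess N₂ lam (P.withDensity (intensityDensity hT N₂ mu lam)) ∧
      IndepFun (fun ω t => N₁ t ω) (fun ω t => N₂ t ω)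
        (P.withDensity (intensityDensity hT N₂ mu lam)) := by
  have h1 := h₂.lintegral_intensityDensity hT hmu hlam
  have h2 := h₂.withDensity hT hmu hlam
  -- The density is a measurable function of the path of `N₂`: it is the same density formed for the
  -- coordinate process on path space.
  obtain ⟨g, hg, hd⟩ : ∃ g : (Set.Icc (0 : ℝ) T → ℕ) → ℝ≥0∞, Measurable g ∧
      intensityDensity hT N₂ mu lam = fun ω => g fun t => N₂ t ω :=
    ⟨intensityDensity hT (fun t f => f t) mu lam,
      measurable_intensityDensity hT (fun t => measurable_pi_apply t) _ _, rfl⟩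
  rw [hd] at h1 h2 ⊢
  refine ⟨h₁.of_preimage_path_eq (withDensity_absolutelyContinuous _ _) fun C hC => ?_, h2, ?_⟩
  · exact withDensity_comp_preimage_left h₁.measurable_path h₂.measurable_path h hg h1 hC
  · exact indepFun_withDensity_comp h₁.measurable_path h₂.measurable_path h hg h1

theorem exists_equivalent_measure_isPoissonProcess [IsProbabilityMeasure P] (hT : 0 ≤ T)
    {mu₁ mu₂ lam₁ lam₂ : ℝ} (hmu₁ : 0 < mu₁) (hmu₂ : 0 < mu₂) (hlam₁ : 0 < lam₁)
    (hlam₂ : 0 < lam₂) (h₁ : IsPoissonProcess N₁ mu₁ P) (h₂ : IsPoissonProcess N₂ mu₂ P)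
    (h : IndepFun (fun ω t => N₁ t ω) (fun ω t => N₂ t ω) P) :
    ∃ Q : Measure Ω, IsProbabilityMeasure Q ∧ IsPoissonProcess N₁ lam₁ Q ∧
      IsPoissonProcess N₂ lam₂ Q ∧ IndepFun (fun ω t => N₁ t ω) (fun ω t => N₂ t ω) Q ∧
      Q ≪ P ∧ P ≪ Q := by
  obtain ⟨k₂, k₁, k⟩ := h₂.pair_withDensity hT hmu₁ hlam₁ h₁ h.symm
  set P₁ := P.withDensity (intensityDensity hT N₁ mu₁ lam₁) with hP₁
  obtain ⟨l₁, l₂, l⟩ := k₁.pair_withDensity hT hmu₂ hlam₂ k₂ k.symm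
  refine ⟨P₁.withDensity (intensityDensity hT N₂ mu₂ lam₂), ⟨?_⟩, l₁, l₂, l, ?_, ?_⟩
  · rw [withDensity_apply _ MeasurableSet.univ, setLIntegral_univ]
    exact k₂.lintegral_intensityDensity hT hmu₂ hlam₂
  · exact (withDensity_absolutelyContinuous _ _).trans (withDensity_absolutelyContinuous _ _)
  · have a₁ : P ≪ P₁ := withDensity_absolutelyContinuous'
      (measurable_intensityDensity hT h₁.measurable _ _).aemeasurable
      (.of_forall fun ω => (intensityDensity_pos hT N₁ mu₁ lam₁ ω).ne')
    exact a₁.trans <| withDensity_absolutelyContinuous'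
      (measurable_intensityDensity hT h₂.measurable _ _).aemeasurable
      (.of_forall fun ω => (intensityDensity_pos hT N₂ mu₂ lam₂ ω).ne')

end

/-! ### Poisson processes give martingale prices -/

theorem IndepFun.prodMk_right_of_prodMk_left {Ω α β γ : Type*} [MeasurableSpace Ω]
    [MeasurableSpace α] [MeasurableSpace β] [MeasurableSpace γ] {P : Measure Ω}
    [IsProbabilityMeasure P] {X : Ω → α} {Z : Ω → β} {Y : Ω → γ} (hX : Measurable X)
    (hZ : Measurable Z) (hY : Measurable Y) (hXZ : IndepFun X Z P)
    (h : IndepFun (fun ω => (X ω, Z ω)) Y P) : IndepFun X (fun ω => (Z ω, Y ω)) P := by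
  have hZY : IndepFun Z Y P := h.comp measurable_snd measurable_id
  rw [indepFun_iff_map_prod_eq_prod_map_map hX.aemeasurable (hZ.prodMk hY).aemeasurable,
    (indepFun_iff_map_prod_eq_prod_map_map hZ.aemeasurable hY.aemeasurable).1 hZY,
    ← Measure.prodAssoc_prod,
    ← (indepFun_iff_map_prod_eq_prod_map_map hX.aemeasurable hZ.aemeasurable).1 hXZ,
    ← (indepFun_iff_map_prod_eq_prod_map_map (hX.prodMk hZ).aemeasurable hY.aemeasurable).1 h,
    Measure.map_map (by fun_prop) (by fun_prop)]
  rfl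

theorem hasSum_poissonMeasure_mean (r : ℝ≥0) :
    HasSum (fun n : ℕ => Real.exp (-r) * r ^ n / (n.factorial : ℝ) * n) r := by
  -- The term at `0` vanishes, and after the shift the factor `n + 1` cancels against the factorial,
  -- leaving `r` times the Poisson weights.
  rw [← hasSum_nat_add_iff' 1]
  have h := (hasSum_one_poissonMeasure r).mul_left (r : ℝ)
  simp only [Finset.range_one, Finset.sum_singleton, Nat.cast_zero, mul_zero, sub_zero]
  rw [mul_one] at h
  refine (congrArg (HasSum · (r : ℝ)) (funext fun n => ?_)).mpr h
  rw [Nat.factorial_succ]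
  push_cast
  field_simp
  ring

theorem integrable_poissonMeasure_cast (r : ℝ≥0) :
    Integrable (fun x : ℝ => x) ((poissonMeasure r).map (Nat.cast : ℕ → ℝ)) := by
  rw [integrable_map_measure (by fun_prop) (by fun_prop)]
  rw [integrable_poissonMeasure_iff]
  simpa using (hasSum_poissonMeasure_mean r).summable

theorem integral_poissonMeasure_cast (r : ℝ≥0) :
    ∫ x : ℝ, x ∂((poissonMeasure r).map (Nat.cast : ℕ → ℝ)) = r := by
  rw [integral_map (by fun_prop) (by fun_prop), integral_poissonMeasure]
  simpa using (hasSum_poissonMeasure_mean r).tsum_eq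

section

variable {Ω : Type*} [mΩ : MeasurableSpace Ω] {T : ℝ} {r : ℝ}
  {N N₁ N₂ : Set.Icc (0 : ℝ) T → Ω → ℕ} {P : Measure Ω}

theorem IsPoissonProcess.integrable_sub (hN : IsPoissonProcess N r P) {s t : Set.Icc (0 : ℝ) T}
    (hst : s ≤ t) : Integrable (fun ω => (N t ω : ℝ) - N s ω) P := by
  have hl := hN.law_increments s t hst
  have h := integrable_poissonMeasure_cast (r * ((t : ℝ) - s)).toNNReal
  rw [← hl.map_eq, integrable_map_measure (by fun_prop) hl.aemeasurable] at h
  exact h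

theorem IsPoissonProcess.integral_sub (hr : 0 ≤ r) (hN : IsPoissonProcess N r P)
    {s t : Set.Icc (0 : ℝ) T} (hst : s ≤ t) :
    ∫ ω, ((N t ω : ℝ) - N s ω) ∂P = r * ((t : ℝ) - s) := by
  have hl := hN.law_increments s t hst
  rw [hl.integral_eq, integral_poissonMeasure_cast,
    Real.coe_toNNReal _ (mul_nonneg hr (sub_nonneg.2 hst))]

theorem IsPoissonProcess.integrable (hN : IsPoissonProcess N r P) (t : Set.Icc (0 : ℝ) T) :
    Integrable (fun ω => (N t ω : ℝ)) P := by
  let z : Set.Icc (0 : ℝ) T := ⟨0, le_rfl, t.2.1.trans t.2.2⟩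
  refine (hN.integrable_sub (s := z) (t := t) t.2.1).congr ?_
  filter_upwards [hN.start_zero z rfl] with ω hω
  simp [hω]

/-- Independence from the whole past reduces to finitely many past times, and the values there are
almost surely partial sums of increments along a partition that starts at `0`. -/
theorem IsPoissonProcess.indepFun_past_increment [IsProbabilityMeasure P]
    (hN : IsPoissonProcess N r P) {s t : Set.Icc (0 : ℝ) T} (hst : s ≤ t) :
    IndepFun (fun ω (u : Set.Iic s) => N u ω) (fun ω => (N t ω : ℝ) - N s ω) P := by
  classical
  refine IndepFun.process_indepFun (fun u => hN.measurable _) (hN.measurable_sub s t) fun I => ?_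
  let z : Set.Icc (0 : ℝ) T := ⟨0, le_rfl, s.2.1.trans s.2.2⟩
  let J : Finset (Set.Icc (0 : ℝ) T) := insert z (I.image Subtype.val)
  have hJs : ∀ u ∈ J, u ≤ s := by
    intro u hu
    rcases Finset.mem_insert.1 hu with rfl | hu
    · exact s.2.1
    · obtain ⟨v, -, rfl⟩ := Finset.mem_image.1 hu
      exact v.2
  have hJ0 : 0 < J.card := Finset.card_pos.2 ⟨z, Finset.mem_insert_self _ _⟩
  obtain ⟨k, hk⟩ : ∃ k, J.card = k := ⟨_, rfl⟩
  rw [hk] at hJ0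
  let e := J.orderIsoOfFin hk
  -- The sorted past times, then `s` at position `k`, then `t`: the increments before `k` describe
  -- the past and increment `k` is the one over `[s, t]`.
  let τ : ℕ → Set.Icc (0 : ℝ) T := fun i => if h : i < k then e ⟨i, h⟩ else if i = k then s else t
  have hτ : Monotone τ := by
    refine monotone_nat_of_le_succ fun i => ?_
    simp only [τ]
    split_ifs
    all_goals first
      | exact le_rfl
      | (exfalso; omega)
      | exact hst
      | exact hJs _ (e _).2
      | exact (e.monotone (by simp [Fin.le_def]))
  have hτ0 : (τ 0 : ℝ) = 0 := by
    have hz : z ∈ J := Finset.mem_insert_self _ _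
    have h1 : τ 0 ≤ z := by
      simp only [τ, hJ0, dif_pos]
      have : e ⟨0, hJ0⟩ ≤ ⟨z, hz⟩ := by
        rw [← e.le_symm_apply]
        exact Nat.zero_le _
      exact this
    exact le_antisymm h1 (τ 0).2.1
  let D : ℕ → Ω → ℝ := fun i ω => (N (τ (i + 1)) ω : ℝ) - N (τ i) ω
  have hD : iIndepFun D P := hN.indep_increments.nat hτ
  have hDm : ∀ i, Measurable (D i) := fun i => hN.measurable_sub _ _
  have hDk : D k = fun ω => (N t ω : ℝ) - N s ω := by
    funext ω
    simp [D, τ]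
  have hind := hD.indepFun_finset (Finset.range k) {k} (by simp) hDm
  let idx : I → ℕ := fun u =>
    e.symm ⟨u.1.1, Finset.mem_insert_of_mem (Finset.mem_image_of_mem _ u.2)⟩
  have hidx : ∀ u : I, idx u < k := fun u => (e.symm _).2
  have hτidx : ∀ u : I, τ (idx u) = u.1.1 := by
    intro u
    simp only [τ, dif_pos (hidx u), idx, Fin.eta, OrderIso.apply_symm_apply]
  -- The increments are real, so the floor turns their partial sums back into the natural values of
  -- `N`.
  let φ : (Finset.range k → ℝ) → I → ℕ := fun x u =>
    ⌊∑ j : Finset.range k, if (j : ℕ) < idx u then x j else 0⌋₊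
  have hφ : Measurable φ := by
    refine measurable_pi_lambda _ fun u => Nat.measurable_floor.comp ?_
    refine Finset.measurable_sum _ fun j _ => ?_
    split_ifs <;> fun_prop
  let ψ : (({k} : Finset ℕ) → ℝ) → ℝ := fun x => x ⟨k, Finset.mem_singleton_self k⟩
  have hψ : Measurable ψ := measurable_pi_apply _
  refine (hind.comp hφ hψ).congr ?_ (.of_forall fun ω => congrFun hDk ω)
  filter_upwards [hN.start_zero _ hτ0] with ω hω
  funext u
  simp only [φ, Function.comp]
  rw [Finset.sum_coe_sort (Finset.range k) (fun j => if j < idx u then D j ω else 0),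
    ← Finset.sum_filter]
  have : (Finset.range k).filter (· < idx u) = Finset.range (idx u) := by
    ext j
    have := hidx u
    simp only [Finset.mem_filter, Finset.mem_range]
    omega
  rw [this, Finset.sum_range_sub (fun i => (N (τ i) ω : ℝ)), hω, hτidx]
  simp

theorem goalFiltration_le_comap (h₁ : ∀ t, Measurable (N₁ t)) (h₂ : ∀ t, Measurable (N₂ t))
    {E : Type*} [mE : MeasurableSpace E] {f : Ω → E} (s : Set.Icc (0 : ℝ) T)
    (hf₁ : ∀ u ≤ s, ∃ g : E → ℕ, Measurable g ∧ N₁ u = g ∘ f)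
    (hf₂ : ∀ u ≤ s, ∃ g : E → ℕ, Measurable g ∧ N₂ u = g ∘ f) :
    goalFiltration N₁ N₂ h₁ h₂ s ≤ mE.comap f := by
  refine iSup₂_le fun u hu => ?_
  obtain ⟨g₁, hg₁, e₁⟩ := hf₁ u hu
  obtain ⟨g₂, hg₂, e₂⟩ := hf₂ u hu
  change MeasurableSpace.comap (fun ω => (N₁ u ω, N₂ u ω)) _ ≤ _
  rw [e₁, e₂]
  exact ((hg₁.prodMk hg₂).comp (comap_measurable f)).comap_le

theorem measurable_goalFiltration_left (h₁ : ∀ t, Measurable (N₁ t)) (h₂ : ∀ t, Measurable (N₂ t))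
    {s t : Set.Icc (0 : ℝ) T} (hst : s ≤ t) :
    Measurable[goalFiltration N₁ N₂ h₁ h₂ t] (N₁ s) := by
  have : Measurable[goalFiltration N₁ N₂ h₁ h₂ t] fun ω => (N₁ s ω, N₂ s ω) :=
    measurable_iff_comap_le.2 (le_iSup₂_of_le s hst le_rfl)
  exact measurable_fst.comp this

theorem measurable_goalFiltration_right (h₁ : ∀ t, Measurable (N₁ t))
    (h₂ : ∀ t, Measurable (N₂ t)) {s t : Set.Icc (0 : ℝ) T} (hst : s ≤ t) :
    Measurable[goalFiltration N₁ N₂ h₁ h₂ t] (N₂ s) := by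
  have : Measurable[goalFiltration N₁ N₂ h₁ h₂ t] fun ω => (N₁ s ω, N₂ s ω) :=
    measurable_iff_comap_le.2 (le_iSup₂_of_le s hst le_rfl)
  exact measurable_snd.comp this

/-- With `Y` the entire path of the other process, the pair on the right generates a `σ`-algebra
containing that of the joint past. -/
theorem IsPoissonProcess.indepFun_increment_past_process [IsProbabilityMeasure P] {β : Type*}
    [MeasurableSpace β] {Y : Ω → β} (hN : IsPoissonProcess N r P) (hY : Measurable Y)
    (h : IndepFun (fun ω t => N t ω) Y P) {s t : Set.Icc (0 : ℝ) T} (hst : s ≤ t) :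
    IndepFun (fun ω => (N t ω : ℝ) - N s ω) (fun ω => (fun u : Set.Iic s => N u ω, Y ω)) P := by
  refine IndepFun.prodMk_right_of_prodMk_left (hN.measurable_sub s t)
    (measurable_pi_lambda _ fun u => hN.measurable _) hY (hN.indepFun_past_increment hst).symm ?_
  have hm : Measurable fun f : Set.Icc (0 : ℝ) T → ℕ =>
      ((f t : ℝ) - f s, fun u : Set.Iic s => f u) := by fun_prop
  exact h.comp hm measurable_id

theorem IsPoissonProcess.martingale_assetPrice [IsProbabilityMeasure P] (hr : 0 ≤ r)
    (hN : IsPoissonProcess N r P) {ℱ : Filtration (Set.Icc (0 : ℝ) T) mΩ}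
    (had : ∀ t, Measurable[ℱ t] (N t))
    (hind : ∀ s t, s ≤ t → Indep (MeasurableSpace.comap (fun ω => (N t ω : ℝ) - N s ω)
      inferInstance) (ℱ s) P) :
    Martingale (assetPrice N r) ℱ P := by
  have hadR : ∀ t, Measurable[ℱ t] fun ω => (N t ω : ℝ) := fun t =>
    (measurable_from_top (f := (Nat.cast : ℕ → ℝ))).comp (had t)
  refine ⟨fun t => ((hadR t).add_const _).stronglyMeasurable, fun s t hst => ?_⟩
  have hsplit : assetPrice N r t = (fun ω => (N t ω : ℝ) - N s ω) +
      fun ω => (N s ω : ℝ) + r * (T - t) := by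
    funext ω
    simp only [assetPrice, Pi.add_apply]
    ring
  have hs : Integrable (fun ω => (N s ω : ℝ) + r * (T - t)) P :=
    (hN.integrable s).add (integrable_const _)
  have h1 := condExp_indep_eq (hN.measurable_sub s t).comap_le (ℱ.le s)
    (comap_measurable (fun ω => (N t ω : ℝ) - N s ω)).stronglyMeasurable (hind s t hst)
  have h2 : P[fun ω => (N s ω : ℝ) + r * (T - t) | ℱ s] = fun ω => (N s ω : ℝ) + r * (T - t) :=
    condExp_of_stronglyMeasurable (ℱ.le s) ((hadR s).add_const _).stronglyMeasurable hs
  rw [hsplit]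
  refine (condExp_add (hN.integrable_sub hst) hs (ℱ s)).trans ?_
  filter_upwards [h1] with ω hω
  rw [Pi.add_apply, hω, h2, hN.integral_sub hr hst]
  simp only [assetPrice]
  ring

theorem isMartingaleMeasure_of_isPoissonProcess [IsProbabilityMeasure P] {lam₁ lam₂ : ℝ}
    (hlam₁ : 0 ≤ lam₁) (hlam₂ : 0 ≤ lam₂) (h₁ : IsPoissonProcess N₁ lam₁ P)
    (h₂ : IsPoissonProcess N₂ lam₂ P)
    (h : IndepFun (fun ω t => N₁ t ω) (fun ω t => N₂ t ω) P) :
    IsMartingaleMeasure (goalFiltration N₁ N₂ h₁.measurable h₂.measurable) N₁ N₂ lam₁ lam₂ P := by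
  refine ⟨martingale_const _ _ _, h₁.martingale_assetPrice hlam₁
    (fun t => measurable_goalFiltration_left _ _ le_rfl) fun s t hst => ?_,
    h₂.martingale_assetPrice hlam₂
    (fun t => measurable_goalFiltration_right _ _ le_rfl) fun s t hst => ?_⟩
  · refine indep_of_indep_of_le_right
      (h₁.indepFun_increment_past_process h₂.measurable_path h hst) ?_
    refine goalFiltration_le_comap _ _ s (fun u hu => ?_) fun u hu => ?_
    · exact ⟨fun p => p.1 ⟨u, hu⟩, by fun_prop, rfl⟩
    · exact ⟨fun p => p.2 u, by fun_prop, rfl⟩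
  · refine indep_of_indep_of_le_right
      (h₂.indepFun_increment_past_process h₁.measurable_path h.symm hst) ?_
    refine goalFiltration_le_comap _ _ s (fun u hu => ?_) fun u hu => ?_
    · exact ⟨fun p => p.2 u, by fun_prop, rfl⟩
    · exact ⟨fun p => p.1 ⟨u, hu⟩, by fun_prop, rfl⟩

end

/-! ### Multiple goals on dyadic grids -/

/-- The complement has mass `exp (-r) * (1 + r) ≥ (1 - r) * (1 + r)`. -/
theorem poissonMeasure_two_le (r : ℝ≥0) :
    (poissonMeasure r) {n | 2 ≤ n} ≤ ENNReal.ofReal ((r : ℝ) ^ 2) := by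
  have hc : {n : ℕ | 2 ≤ n}ᶜ = ({0, 1} : Finset ℕ) := by
    ext n
    simp
    omega
  have h := prob_compl_eq_one_sub (μ := poissonMeasure r) (s := {n : ℕ | 2 ≤ n}ᶜ) (by measurability)
  rw [compl_compl, hc, ← sum_measure_singleton] at h
  rw [h, Finset.sum_pair (by norm_num), poissonMeasure_singleton, poissonMeasure_singleton,
    ← ENNReal.ofReal_add (by positivity) (by positivity), ← ENNReal.ofReal_one,
    ← ENNReal.ofReal_sub _ (by positivity)]
  refine ENNReal.ofReal_le_ofReal ?_
  have he : 1 - (r : ℝ) ≤ Real.exp (-r) := by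
    linarith [Real.add_one_le_exp (-(r : ℝ))]
  have hr : (0 : ℝ) ≤ r := r.2
  simp
  nlinarith

/-- The `k`-th point of the partition of `[s, t]` into `m` intervals of equal length. -/
noncomputable def gridPoint {T : ℝ} (s t : Set.Icc (0 : ℝ) T) (m k : ℕ) : Set.Icc (0 : ℝ) T :=
  Set.projIcc 0 T (s.2.1.trans s.2.2) (s + k * (((t : ℝ) - s) / m))

section Grid

variable {T : ℝ} {s t : Set.Icc (0 : ℝ) T}

theorem coe_gridPoint (hst : s ≤ t) {m k : ℕ} (hk : k ≤ m) :
    (gridPoint s t m k : ℝ) = s + k * (((t : ℝ) - s) / m) := by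
  have hd : 0 ≤ (t : ℝ) - s := sub_nonneg.2 hst
  have h1 : (k : ℝ) * (((t : ℝ) - s) / m) ≤ (t : ℝ) - s := by
    rcases Nat.eq_zero_or_pos m with rfl | hm
    · simpa using hd
    · have hkm : (k : ℝ) ≤ m := by exact_mod_cast hk
      have hm' : (0 : ℝ) < m := by exact_mod_cast hm
      rw [mul_div_assoc', div_le_iff₀ hm']
      nlinarith
  have h2 : 0 ≤ (k : ℝ) * (((t : ℝ) - s) / m) := by positivity
  rw [gridPoint, Set.projIcc_of_mem _ ⟨by linarith [s.2.1], by linarith [t.2.2]⟩]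

theorem monotone_gridPoint (hst : s ≤ t) (m : ℕ) : Monotone (gridPoint s t m) := by
  intro a b hab
  refine Set.monotone_projIcc _ ?_
  have hd : 0 ≤ ((t : ℝ) - s) / m := div_nonneg (sub_nonneg.2 hst) (Nat.cast_nonneg m)
  have : (a : ℝ) ≤ b := by exact_mod_cast hab
  nlinarith

theorem gridPoint_zero (s t : Set.Icc (0 : ℝ) T) (m : ℕ) : gridPoint s t m 0 = s := by
  simp [gridPoint]

theorem gridPoint_self (s t : Set.Icc (0 : ℝ) T) {m : ℕ} (hm : m ≠ 0) : gridPoint s t m m = t := by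
  have : (m : ℝ) ≠ 0 := by exact_mod_cast hm
  have h : (s : ℝ) + m * (((t : ℝ) - s) / m) = t := by field_simp; ring
  rw [gridPoint, h, Set.projIcc_val]

theorem gridPoint_succ_sub (hst : s ≤ t) {m k : ℕ} (hk : k < m) :
    (gridPoint s t m (k + 1) : ℝ) - gridPoint s t m k = ((t : ℝ) - s) / m := by
  rw [coe_gridPoint hst hk, coe_gridPoint hst hk.le]
  push_cast
  ring

end Grid

section

variable {Ω : Type*} [mΩ : MeasurableSpace Ω] {T : ℝ}
  {N N₁ N₂ : Set.Icc (0 : ℝ) T → Ω → ℕ} {P : Measure Ω}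

theorem measure_two_le_increment {r₁ r₂ : ℝ} (hr₁ : 0 ≤ r₁) (hr₂ : 0 ≤ r₂)
    (h₁ : IsPoissonProcess N₁ r₁ P) (h₂ : IsPoissonProcess N₂ r₂ P)
    (h : IndepFun (fun ω t => N₁ t ω) (fun ω t => N₂ t ω) P) {s t : Set.Icc (0 : ℝ) T}
    (hst : s ≤ t) :
    P {ω | N₁ s ω + N₂ s ω + 1 < N₁ t ω + N₂ t ω} ≤
      ENNReal.ofReal (((r₁ + r₂) * ((t : ℝ) - s)) ^ 2) := by
  have hd : 0 ≤ (t : ℝ) - s := sub_nonneg.2 hst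
  have hm : Measurable fun f : Set.Icc (0 : ℝ) T → ℕ => (f t : ℝ) - f s := by fun_prop
  have hind : IndepFun (fun ω => (N₁ t ω : ℝ) - N₁ s ω) (fun ω => (N₂ t ω : ℝ) - N₂ s ω) P :=
    h.comp hm hm
  have hl := hind.hasLaw_add_map_cast_poissonMeasure (h₁.law_increments s t hst)
    (h₂.law_increments s t hst)
  rw [← Real.toNNReal_add (by positivity) (by positivity), ← add_mul] at hl
  have hset : {ω | N₁ s ω + N₂ s ω + 1 < N₁ t ω + N₂ t ω} =
      ((fun ω => (N₁ t ω : ℝ) - N₁ s ω) + fun ω => (N₂ t ω : ℝ) - N₂ s ω) ⁻¹' Set.Ioi 1 := by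
    ext ω
    simp only [Set.mem_ofPred_eq, Set.mem_preimage, Pi.add_apply, Set.mem_Ioi]
    rw [← Nat.cast_lt (α := ℝ)]
    push_cast
    constructor <;> intro h <;> linarith
  rw [hset, ← Measure.map_apply_of_aemeasurable hl.aemeasurable measurableSet_Ioi, hl.map_eq,
    Measure.map_apply (by fun_prop) measurableSet_Ioi]
  have hset' : (Nat.cast : ℕ → ℝ) ⁻¹' Set.Ioi 1 = {n | 2 ≤ n} := by
    ext n
    simp [Nat.succ_le_iff]
  rw [hset']
  refine (poissonMeasure_two_le _).trans_eq ?_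
  rw [Real.coe_toNNReal _ (by positivity)]

/-- Borel–Cantelli: each of the `2 ^ n` intervals has two or more goals with probability at most `c
/ 4 ^ n`, so the bad events have probability at most `c / 2 ^ n`, which is summable. -/
theorem ae_eventually_grid_increment_le_one {r₁ r₂ : ℝ} (hr₁ : 0 ≤ r₁) (hr₂ : 0 ≤ r₂)
    (h₁ : IsPoissonProcess N₁ r₁ P) (h₂ : IsPoissonProcess N₂ r₂ P)
    (h : IndepFun (fun ω t => N₁ t ω) (fun ω t => N₂ t ω) P) {s t : Set.Icc (0 : ℝ) T}
    (hst : s ≤ t) :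
    ∀ᵐ ω ∂P, ∀ᶠ n : ℕ in atTop, ∀ k < 2 ^ n,
      N₁ (gridPoint s t (2 ^ n) (k + 1)) ω + N₂ (gridPoint s t (2 ^ n) (k + 1)) ω ≤
        N₁ (gridPoint s t (2 ^ n) k) ω + N₂ (gridPoint s t (2 ^ n) k) ω + 1 := by
  let A : ℕ → Set Ω := fun n => ⋃ k ∈ Finset.range (2 ^ n),
    {ω | N₁ (gridPoint s t (2 ^ n) k) ω + N₂ (gridPoint s t (2 ^ n) k) ω + 1 <
      N₁ (gridPoint s t (2 ^ n) (k + 1)) ω + N₂ (gridPoint s t (2 ^ n) (k + 1)) ω}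
  set c : ℝ := ((r₁ + r₂) * ((t : ℝ) - s)) ^ 2 with hc
  have hA : ∀ n, P (A n) ≤ ENNReal.ofReal (c * (1 / 2) ^ n) := by
    intro n
    refine (measure_biUnion_finset_le _ _).trans ?_
    have hk : ∀ k ∈ Finset.range (2 ^ n),
        P {ω | N₁ (gridPoint s t (2 ^ n) k) ω + N₂ (gridPoint s t (2 ^ n) k) ω + 1 <
          N₁ (gridPoint s t (2 ^ n) (k + 1)) ω + N₂ (gridPoint s t (2 ^ n) (k + 1)) ω} ≤
        ENNReal.ofReal (c / (2 ^ n) ^ 2) := by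
      intro k hk
      refine (measure_two_le_increment hr₁ hr₂ h₁ h₂ h
        (monotone_gridPoint hst _ (Nat.le_succ k))).trans_eq ?_
      rw [gridPoint_succ_sub hst (Finset.mem_range.1 hk), hc, ← mul_div_assoc, div_pow]
      push_cast
      rfl
    refine (Finset.sum_le_sum hk).trans_eq ?_
    rw [Finset.sum_const, Finset.card_range, ← ENNReal.ofReal_nsmul]
    congr 1
    rw [nsmul_eq_mul]
    push_cast
    rw [one_div, inv_pow]
    field_simp
  have hsum : ∑' n, P (A n) ≠ ∞ := by
    refine ne_top_of_le_ne_top ?_ (ENNReal.tsum_le_tsum hA)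
    have hs : Summable fun n : ℕ => c * (1 / 2 : ℝ) ^ n := summable_geometric_two.mul_left c
    rw [← ENNReal.ofReal_tsum_of_nonneg (fun n => by positivity) hs]
    exact ENNReal.ofReal_ne_top
  filter_upwards [ae_eventually_notMem hsum] with ω hω
  filter_upwards [hω] with n hn k hk
  by_contra hlt
  refine hn (Set.mem_biUnion (Finset.mem_coe.2 (Finset.mem_range.2 hk)) ?_)
  simpa using hlt

/-- Only countably many times enter. Applied with the terminal `σ`-algebra in place of the ambient
one, this lets the event pass to a measure whose null sets are controlled only there. -/
theorem measurableSet_eventually_grid_increment_le_one (h₁ : ∀ t, Measurable (N₁ t))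
    (h₂ : ∀ t, Measurable (N₂ t)) (s t : Set.Icc (0 : ℝ) T) :
    MeasurableSet {ω | ∀ᶠ n : ℕ in atTop, ∀ k < 2 ^ n,
      N₁ (gridPoint s t (2 ^ n) (k + 1)) ω + N₂ (gridPoint s t (2 ^ n) (k + 1)) ω ≤
        N₁ (gridPoint s t (2 ^ n) k) ω + N₂ (gridPoint s t (2 ^ n) k) ω + 1} := by
  simp only [eventually_atTop, Set.ofPred_exists, Set.ofPred_forall]
  refine MeasurableSet.iUnion fun a => MeasurableSet.iInter fun n => MeasurableSet.iInter fun _ =>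
    MeasurableSet.iInter fun k => MeasurableSet.iInter fun _ => ?_
  exact measurableSet_le ((h₁ _).add (h₂ _)) (((h₁ _).add (h₂ _)).add_const 1)

/-! ### Watanabe's characterization through characteristic functions -/

theorem integrable_of_martingale_assetPrice {ℱ : Filtration (Set.Icc (0 : ℝ) T) mΩ} {lam : ℝ}
    [IsFiniteMeasure P] (hM : Martingale (assetPrice N lam) ℱ P) (t : Set.Icc (0 : ℝ) T) :
    Integrable (fun ω => (N t ω : ℝ)) P := by
  refine ((hM.integrable t).sub (integrable_const (lam * (T - t)))).congr ?_
  exact .of_forall fun ω => by simp [assetPrice]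

theorem integral_mul_increment_of_martingale_assetPrice {ℱ : Filtration (Set.Icc (0 : ℝ) T) mΩ} {lam : ℝ}
    [IsFiniteMeasure P] (hM : Martingale (assetPrice N lam) ℱ P) {u v : Set.Icc (0 : ℝ) T}
    (huv : u ≤ v) {G : Ω → ℂ} (hG : Measurable[ℱ u] G) (hG1 : ∀ ω, ‖G ω‖ ≤ 1) :
    ∫ ω, G ω * ((N v ω : ℂ) - N u ω) ∂P = (lam * ((v : ℝ) - u) : ℝ) * ∫ ω, G ω ∂P := by
  have hGm : Measurable G := hG.mono (ℱ.le u) le_rfl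
  set d : Ω → ℝ := fun ω => (N v ω : ℝ) - N u ω with hd
  have hdint : Integrable d P := (integrable_of_martingale_assetPrice hM v).sub (integrable_of_martingale_assetPrice hM u)
  have hd_eq : d = (assetPrice N lam v - assetPrice N lam u) +
      fun _ => lam * ((v : ℝ) - u) := by
    funext ω
    simp only [hd, assetPrice, Pi.add_apply, Pi.sub_apply]
    ring
  have hcond : P[d | ℱ u] =ᵐ[P] fun _ => lam * ((v : ℝ) - u) := by
    rw [hd_eq]
    have e1 := condExp_add ((hM.integrable v).sub (hM.integrable u))
      (integrable_const (μ := P) (lam * ((v : ℝ) - u))) (ℱ u)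
    have e2 := condExp_sub (hM.integrable v) (hM.integrable u) (ℱ u)
    have e3 := hM.2 u v huv
    have e4 := hM.2 u u le_rfl
    filter_upwards [e1, e2, e3, e4] with ω w1 w2 w3 w4
    rw [w1, Pi.add_apply, w2, Pi.sub_apply, w3, w4, condExp_const (ℱ.le u)]
    ring
  -- Multiplication as a real bilinear map, so that the complex factor `G` can be pulled out of the
  -- conditional expectation of a real increment.
  let B : ℂ →L[ℝ] ℝ →L[ℝ] ℂ := (ContinuousLinearMap.lsmul ℝ ℝ).flip
  have hB : ∀ (z : ℂ) (x : ℝ), B z x = z * x := fun z x => by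
    simp [B, mul_comm]
  have hint : Integrable (fun ω => B (G ω) (d ω)) P := by
    simp only [hB]
    exact hdint.ofReal.bdd_mul hGm.aestronglyMeasurable (.of_forall hG1)
  have hpull := condExp_bilin_of_stronglyMeasurable_left B hG.stronglyMeasurable hint hdint
  calc ∫ ω, G ω * ((N v ω : ℂ) - N u ω) ∂P = ∫ ω, B (G ω) (d ω) ∂P := by
        refine integral_congr_ae (.of_forall fun ω => ?_)
        simp [hB, hd]
    _ = ∫ ω, (P[fun ω => B (G ω) (d ω) | ℱ u]) ω ∂P := (integral_condExp (ℱ.le u)).symm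
    _ = ∫ ω, ((lam * ((v : ℝ) - u) : ℝ) : ℂ) * G ω ∂P := by
        refine integral_congr_ae ?_
        filter_upwards [hpull, hcond] with ω w1 w2
        rw [w1, w2, hB, mul_comm]
    _ = _ := integral_const_mul _ _

end

/-- If `a` satisfies a linear recursion with ratio `c` up to the errors `ε`, then it is geometric
up to the accumulated errors. -/
theorem norm_sub_pow_mul_le_of_recursion {a : ℕ → ℂ} {ε : ℕ → ℝ} {c : ℂ} {C : ℝ} (hC : 1 ≤ C)
    (hc : ‖c‖ ≤ C) (hε : ∀ k, 0 ≤ ε k) {m : ℕ} (h : ∀ k < m, ‖a (k + 1) - c * a k‖ ≤ ε k) :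
    ∀ k ≤ m, ‖a k - c ^ k * a 0‖ ≤ C ^ k * ∑ j ∈ Finset.range k, ε j := by
  intro k
  induction k with
  | zero => simp
  | succ k ih =>
    intro hk
    have hS : 0 ≤ ∑ j ∈ Finset.range k, ε j := Finset.sum_nonneg fun j _ => hε j
    have h1 := h k hk
    have h2 := ih (Nat.le_of_succ_le hk)
    have hCk : 1 ≤ C ^ (k + 1) := one_le_pow₀ hC
    calc ‖a (k + 1) - c ^ (k + 1) * a 0‖
        = ‖(a (k + 1) - c * a k) + c * (a k - c ^ k * a 0)‖ := by congr 1; ring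
      _ ≤ ‖a (k + 1) - c * a k‖ + ‖c‖ * ‖a k - c ^ k * a 0‖ := by
        rw [← norm_mul]
        exact norm_add_le _ _
      _ ≤ ε k + C * (C ^ k * ∑ j ∈ Finset.range k, ε j) := by gcongr
      _ ≤ C ^ (k + 1) * ε k + C ^ (k + 1) * ∑ j ∈ Finset.range k, ε j := by
        rw [← mul_assoc, ← pow_succ']
        gcongr
        exact le_mul_of_one_le_left (hε k) hCk
      _ = C ^ (k + 1) * ∑ j ∈ Finset.range (k + 1), ε j := by
        rw [Finset.sum_range_succ]; ring

/-- With at most one jump the expansion is exact; otherwise the crude bound `2 + 2 * (p + q)`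
suffices, since `p + q ≥ 2`. -/
theorem norm_pow_mul_pow_sub_linear_le {z w : ℂ} (hz : ‖z‖ ≤ 1) (hw : ‖w‖ ≤ 1) (p q : ℕ) :
    ‖z ^ p * w ^ q - 1 - ((z - 1) * p + (w - 1) * q)‖ ≤
      if p + q ≤ 1 then 0 else 4 * ((p : ℝ) + q) := by
  split_ifs with h
  · have : (p = 0 ∧ q = 0) ∨ (p = 1 ∧ q = 0) ∨ (p = 0 ∧ q = 1) := by omega
    rcases this with ⟨rfl, rfl⟩ | ⟨rfl, rfl⟩ | ⟨rfl, rfl⟩ <;> simp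
  · have hpq : (2 : ℝ) ≤ p + q := by exact_mod_cast (by omega : 2 ≤ p + q)
    have e1 : ‖z ^ p * w ^ q‖ ≤ 1 := by
      rw [norm_mul, norm_pow, norm_pow]
      exact mul_le_one₀ (pow_le_one₀ (norm_nonneg _) hz) (by positivity)
        (pow_le_one₀ (norm_nonneg _) hw)
    have e2 : ‖z - 1‖ ≤ 2 := (norm_sub_le _ _).trans (by rw [norm_one]; linarith)
    have e3 : ‖w - 1‖ ≤ 2 := (norm_sub_le _ _).trans (by rw [norm_one]; linarith)
    have e4 : ‖(z - 1) * p + (w - 1) * q‖ ≤ 2 * p + 2 * q := by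
      refine (norm_add_le _ _).trans ?_
      rw [norm_mul, norm_mul, Complex.norm_natCast, Complex.norm_natCast]
      gcongr
    have e5 : ‖z ^ p * w ^ q - 1‖ ≤ 2 := (norm_sub_le _ _).trans (by rw [norm_one]; linarith)
    refine (norm_sub_le _ _).trans ?_
    linarith

section

variable {Ω : Type*} [mΩ : MeasurableSpace Ω] {T : ℝ}
  {N₁ N₂ : Set.Icc (0 : ℝ) T → Ω → ℕ} {P : Measure Ω}

/-- Four times the number of goals scored in `(u, v]` if there are at least two of them. -/
noncomputable def multipleGoals (N₁ N₂ : Set.Icc (0 : ℝ) T → Ω → ℕ) (u v : Set.Icc (0 : ℝ) T)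
    (ω : Ω) : ℝ :=
  if N₁ v ω + N₂ v ω ≤ N₁ u ω + N₂ u ω + 1 then 0 else
    4 * (((N₁ v ω : ℝ) - N₁ u ω) + ((N₂ v ω : ℝ) - N₂ u ω))

theorem measurable_multipleGoals (h₁ : ∀ t, Measurable (N₁ t)) (h₂ : ∀ t, Measurable (N₂ t))
    (u v : Set.Icc (0 : ℝ) T) : Measurable (multipleGoals N₁ N₂ u v) := by
  have := h₁ u
  have := h₁ v
  have := h₂ u
  have := h₂ v
  refine Measurable.ite (measurableSet_le (by fun_prop) (by fun_prop)) measurable_const ?_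
  fun_prop

omit mΩ in
theorem multipleGoals_nonneg {u v : Set.Icc (0 : ℝ) T} {ω : Ω} (h₁ : N₁ u ω ≤ N₁ v ω)
    (h₂ : N₂ u ω ≤ N₂ v ω) : 0 ≤ multipleGoals N₁ N₂ u v ω := by
  have h₁' : (N₁ u ω : ℝ) ≤ N₁ v ω := by exact_mod_cast h₁
  have h₂' : (N₂ u ω : ℝ) ≤ N₂ v ω := by exact_mod_cast h₂
  unfold multipleGoals
  split_ifs
  · exact le_rfl
  · linarith

omit mΩ in
theorem multipleGoals_le {u v : Set.Icc (0 : ℝ) T} {ω : Ω} (h₁ : N₁ u ω ≤ N₁ v ω)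
    (h₂ : N₂ u ω ≤ N₂ v ω) : multipleGoals N₁ N₂ u v ω ≤
      4 * (((N₁ v ω : ℝ) - N₁ u ω) + ((N₂ v ω : ℝ) - N₂ u ω)) := by
  have h₁' : (N₁ u ω : ℝ) ≤ N₁ v ω := by exact_mod_cast h₁
  have h₂' : (N₂ u ω : ℝ) ≤ N₂ v ω := by exact_mod_cast h₂
  unfold multipleGoals
  split_ifs
  · linarith
  · exact le_rfl

/-- The unimodular process `exp (i (θ N₁ + η N₂))`. -/
noncomputable def goalChar (N₁ N₂ : Set.Icc (0 : ℝ) T → Ω → ℕ) (θ η : ℝ)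
    (t : Set.Icc (0 : ℝ) T) (ω : Ω) : ℂ :=
  Complex.exp (((θ * N₁ t ω + η * N₂ t ω : ℝ) : ℂ) * Complex.I)

omit mΩ in
theorem norm_goalChar (θ η : ℝ) (t : Set.Icc (0 : ℝ) T) (ω : Ω) :
    ‖goalChar N₁ N₂ θ η t ω‖ = 1 :=
  Complex.norm_exp_ofReal_mul_I _

theorem measurable_goalChar {θ η : ℝ} {t : Set.Icc (0 : ℝ) T} (h₁ : Measurable (N₁ t))
    (h₂ : Measurable (N₂ t)) : Measurable (goalChar N₁ N₂ θ η t) := by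
  unfold goalChar
  fun_prop

omit mΩ in
theorem goalChar_eq_mul {θ η : ℝ} {u v : Set.Icc (0 : ℝ) T} {ω : Ω} (h₁ : N₁ u ω ≤ N₁ v ω)
    (h₂ : N₂ u ω ≤ N₂ v ω) : goalChar N₁ N₂ θ η v ω = goalChar N₁ N₂ θ η u ω *
      (Complex.exp (θ * Complex.I) ^ (N₁ v ω - N₁ u ω) *
        Complex.exp (η * Complex.I) ^ (N₂ v ω - N₂ u ω)) := by
  rw [← Complex.exp_nat_mul, ← Complex.exp_nat_mul, goalChar, goalChar, ← Complex.exp_add,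
    ← Complex.exp_add, Nat.cast_sub h₁, Nat.cast_sub h₂]
  congr 1
  push_cast
  ring

/-- The infinitesimal exponent of the characteristic function of a pair of independent Poisson
processes. -/
noncomputable def poissonExponent (lam₁ lam₂ θ η : ℝ) : ℂ :=
  lam₁ * (Complex.exp (θ * Complex.I) - 1) + lam₂ * (Complex.exp (η * Complex.I) - 1)

omit mΩ in
theorem norm_goalChar_sub_linear_le {θ η : ℝ} {u v : Set.Icc (0 : ℝ) T} {ω : Ω} {z : ℂ}
    (hz : ‖z‖ ≤ 1) (h₁ : N₁ u ω ≤ N₁ v ω) (h₂ : N₂ u ω ≤ N₂ v ω) :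
    ‖z * goalChar N₁ N₂ θ η v ω - (z * goalChar N₁ N₂ θ η u ω +
      ((Complex.exp (θ * Complex.I) - 1) *
        (z * goalChar N₁ N₂ θ η u ω * ((N₁ v ω : ℂ) - N₁ u ω)) +
      (Complex.exp (η * Complex.I) - 1) *
        (z * goalChar N₁ N₂ θ η u ω * ((N₂ v ω : ℂ) - N₂ u ω))))‖ ≤
      multipleGoals N₁ N₂ u v ω := by
  have hb := norm_pow_mul_pow_sub_linear_le (Complex.norm_exp_ofReal_mul_I θ).le
    (Complex.norm_exp_ofReal_mul_I η).le (N₁ v ω - N₁ u ω) (N₂ v ω - N₂ u ω)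
  have hr : (if N₁ v ω - N₁ u ω + (N₂ v ω - N₂ u ω) ≤ 1 then 0 else
      4 * (((N₁ v ω - N₁ u ω : ℕ) : ℝ) + ((N₂ v ω - N₂ u ω : ℕ) : ℝ))) =
      multipleGoals N₁ N₂ u v ω := by
    rw [Nat.cast_sub h₁, Nat.cast_sub h₂, multipleGoals]
    refine if_congr ?_ rfl rfl
    omega
  rw [hr, Nat.cast_sub h₁, Nat.cast_sub h₂] at hb
  refine le_trans ?_ hb
  rw [goalChar_eq_mul h₁ h₂]
  set X := goalChar N₁ N₂ θ η u ω with hX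
  set A := Complex.exp (θ * Complex.I) ^ (N₁ v ω - N₁ u ω) *
        Complex.exp (η * Complex.I) ^ (N₂ v ω - N₂ u ω) with hA
  set a := Complex.exp (θ * Complex.I)
  set b := Complex.exp (η * Complex.I)
  have hXn : ‖z * X‖ ≤ 1 := by
    rw [norm_mul, hX, norm_goalChar, mul_one]
    exact hz
  calc _ = ‖(z * X) * (A - 1 - ((a - 1) * ((N₁ v ω : ℂ) - N₁ u ω) +
          (b - 1) * ((N₂ v ω : ℂ) - N₂ u ω)))‖ := by congr 1; ring
    _ ≤ _ := by
      rw [norm_mul]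
      exact mul_le_of_le_one_left (norm_nonneg _) hXn

theorem integrable_multipleGoals [IsFiniteMeasure P] (h₁ : ∀ t, Measurable (N₁ t))
    (h₂ : ∀ t, Measurable (N₂ t)) (hi₁ : ∀ t, Integrable (fun ω => (N₁ t ω : ℝ)) P)
    (hi₂ : ∀ t, Integrable (fun ω => (N₂ t ω : ℝ)) P)
    {u v : Set.Icc (0 : ℝ) T} (hm₁ : ∀ᵐ ω ∂P, N₁ u ω ≤ N₁ v ω)
    (hm₂ : ∀ᵐ ω ∂P, N₂ u ω ≤ N₂ v ω) : Integrable (multipleGoals N₁ N₂ u v) P := by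
  refine Integrable.mono' ((((hi₁ v).sub (hi₁ u)).add ((hi₂ v).sub (hi₂ u))).const_mul 4)
    (measurable_multipleGoals h₁ h₂ u v).aestronglyMeasurable ?_
  filter_upwards [hm₁, hm₂] with ω w₁ w₂
  rw [Real.norm_of_nonneg (multipleGoals_nonneg w₁ w₂)]
  exact multipleGoals_le w₁ w₂

variable {ℱ : Filtration (Set.Icc (0 : ℝ) T) mΩ} {lam₁ lam₂ : ℝ}

/-- The martingale property evaluates the linear terms of the expansion, and only the multiple goals
remain as error. -/
theorem norm_integral_goalChar_step_le [IsFiniteMeasure P] (ha₁ : ∀ t, Measurable[ℱ t] (N₁ t))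
    (ha₂ : ∀ t, Measurable[ℱ t] (N₂ t)) (hM₁ : Martingale (assetPrice N₁ lam₁) ℱ P)
    (hM₂ : Martingale (assetPrice N₂ lam₂) ℱ P) {u v : Set.Icc (0 : ℝ) T} (huv : u ≤ v)
    (hm₁ : ∀ᵐ ω ∂P, N₁ u ω ≤ N₁ v ω) (hm₂ : ∀ᵐ ω ∂P, N₂ u ω ≤ N₂ v ω) {F : Ω → ℂ}
    (hF : Measurable[ℱ u] F) (hF1 : ∀ ω, ‖F ω‖ ≤ 1) (θ η : ℝ) :
    ‖∫ ω, F ω * goalChar N₁ N₂ θ η v ω ∂P -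
      (1 + ((v : ℝ) - u : ℝ) * poissonExponent lam₁ lam₂ θ η) *
        ∫ ω, F ω * goalChar N₁ N₂ θ η u ω ∂P‖ ≤ ∫ ω, multipleGoals N₁ N₂ u v ω ∂P := by
  have h₁ : ∀ t, Measurable (N₁ t) := fun t => (ha₁ t).mono (ℱ.le t) le_rfl
  have h₂ : ∀ t, Measurable (N₂ t) := fun t => (ha₂ t).mono (ℱ.le t) le_rfl
  have hi₁ := integrable_of_martingale_assetPrice hM₁
  have hi₂ := integrable_of_martingale_assetPrice hM₂
  have hFm : Measurable F := hF.mono (ℱ.le u) le_rfl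
  have hG : Measurable[ℱ u] fun ω => F ω * goalChar N₁ N₂ θ η u ω :=
    hF.mul (measurable_goalChar (mΩ := ℱ u) (ha₁ u) (ha₂ u))
  have hG1 : ∀ t ω, ‖F ω * goalChar N₁ N₂ θ η t ω‖ ≤ 1 := fun t ω => by
    rw [norm_mul, norm_goalChar, mul_one]
    exact hF1 ω
  have hGi : ∀ t, Integrable (fun ω => F ω * goalChar N₁ N₂ θ η t ω) P := fun t =>
    Integrable.of_bound (hFm.mul (measurable_goalChar (h₁ t) (h₂ t))).aestronglyMeasurable 1
      (.of_forall (hG1 t))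
  have hd₁ : Integrable (fun ω => F ω * goalChar N₁ N₂ θ η u ω * ((N₁ v ω : ℂ) - N₁ u ω)) P := by
    have := ((hi₁ v).sub (hi₁ u)).ofReal (𝕜 := ℂ)
    refine Integrable.bdd_mul (c := 1) ?_ (hGi u).aestronglyMeasurable (.of_forall (hG1 u))
    simpa using this
  have hd₂ : Integrable (fun ω => F ω * goalChar N₁ N₂ θ η u ω * ((N₂ v ω : ℂ) - N₂ u ω)) P := by
    have := ((hi₂ v).sub (hi₂ u)).ofReal (𝕜 := ℂ)
    refine Integrable.bdd_mul (c := 1) ?_ (hGi u).aestronglyMeasurable (.of_forall (hG1 u))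
    simpa using this
  have e₁ := integral_mul_increment_of_martingale_assetPrice hM₁ huv hG (hG1 u)
  have e₂ := integral_mul_increment_of_martingale_assetPrice hM₂ huv hG (hG1 u)
  have hs : Integrable (fun ω => (Complex.exp (θ * Complex.I) - 1) *
        (F ω * goalChar N₁ N₂ θ η u ω * ((N₁ v ω : ℂ) - N₁ u ω)) +
      (Complex.exp (η * Complex.I) - 1) *
        (F ω * goalChar N₁ N₂ θ η u ω * ((N₂ v ω : ℂ) - N₂ u ω))) P :=
    (hd₁.const_mul _).add (hd₂.const_mul _)
  have hl : Integrable (fun ω => F ω * goalChar N₁ N₂ θ η u ω +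
      ((Complex.exp (θ * Complex.I) - 1) *
        (F ω * goalChar N₁ N₂ θ η u ω * ((N₁ v ω : ℂ) - N₁ u ω)) +
      (Complex.exp (η * Complex.I) - 1) *
        (F ω * goalChar N₁ N₂ θ η u ω * ((N₂ v ω : ℂ) - N₂ u ω)))) P :=
    (hGi u).add hs
  have hlin : (1 + ((v : ℝ) - u : ℝ) * poissonExponent lam₁ lam₂ θ η) *
        ∫ ω, F ω * goalChar N₁ N₂ θ η u ω ∂P =
      ∫ ω, (F ω * goalChar N₁ N₂ θ η u ω +
      ((Complex.exp (θ * Complex.I) - 1) *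
        (F ω * goalChar N₁ N₂ θ η u ω * ((N₁ v ω : ℂ) - N₁ u ω)) +
      (Complex.exp (η * Complex.I) - 1) *
        (F ω * goalChar N₁ N₂ θ η u ω * ((N₂ v ω : ℂ) - N₂ u ω)))) ∂P := by
    rw [integral_add (hGi u) hs,
      integral_add (hd₁.const_mul _) (hd₂.const_mul _), integral_const_mul, integral_const_mul,
      e₁, e₂, poissonExponent]
    push_cast
    ring
  rw [hlin, ← integral_sub (hGi v) hl]
  refine norm_integral_le_of_norm_le (integrable_multipleGoals h₁ h₂ hi₁ hi₂ hm₁ hm₂) ?_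
  filter_upwards [hm₁, hm₂] with ω w₁ w₂
  exact norm_goalChar_sub_linear_le (hF1 ω) w₁ w₂

/-- Dominated convergence: the sum is eventually zero almost surely, and by telescoping it is at
most four times the number of goals in `(s, t]`, which is integrable. -/
theorem tendsto_sum_integral_multipleGoals [IsFiniteMeasure P] (h₁ : ∀ t, Measurable (N₁ t))
    (h₂ : ∀ t, Measurable (N₂ t)) (hi₁ : ∀ t, Integrable (fun ω => (N₁ t ω : ℝ)) P)
    (hi₂ : ∀ t, Integrable (fun ω => (N₂ t ω : ℝ)) P)
    (hm₁ : ∀ u v, u ≤ v → ∀ᵐ ω ∂P, N₁ u ω ≤ N₁ v ω)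
    (hm₂ : ∀ u v, u ≤ v → ∀ᵐ ω ∂P, N₂ u ω ≤ N₂ v ω) {s t : Set.Icc (0 : ℝ) T} (hst : s ≤ t)
    (hj : ∀ᵐ ω ∂P, ∀ᶠ n : ℕ in atTop, ∀ k < 2 ^ n,
      N₁ (gridPoint s t (2 ^ n) (k + 1)) ω + N₂ (gridPoint s t (2 ^ n) (k + 1)) ω ≤
        N₁ (gridPoint s t (2 ^ n) k) ω + N₂ (gridPoint s t (2 ^ n) k) ω + 1) :
    Tendsto (fun n : ℕ => ∑ k ∈ Finset.range (2 ^ n), ∫ ω, multipleGoals N₁ N₂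
      (gridPoint s t (2 ^ n) k) (gridPoint s t (2 ^ n) (k + 1)) ω ∂P) atTop (𝓝 0) := by
  have hle : ∀ n k, gridPoint s t (2 ^ n) k ≤ gridPoint s t (2 ^ n) (k + 1) := fun n k =>
    monotone_gridPoint hst _ (Nat.le_succ k)
  have hsum : ∀ n : ℕ, ∑ k ∈ Finset.range (2 ^ n), ∫ ω, multipleGoals N₁ N₂
      (gridPoint s t (2 ^ n) k) (gridPoint s t (2 ^ n) (k + 1)) ω ∂P =
      ∫ ω, ∑ k ∈ Finset.range (2 ^ n), multipleGoals N₁ N₂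
      (gridPoint s t (2 ^ n) k) (gridPoint s t (2 ^ n) (k + 1)) ω ∂P := fun n =>
    (integral_finsetSum _ fun k _ => integrable_multipleGoals h₁ h₂ hi₁ hi₂
      (hm₁ _ _ (hle n k)) (hm₂ _ _ (hle n k))).symm
  simp only [hsum]
  rw [← integral_zero Ω ℝ (μ := P)]
  refine tendsto_integral_of_dominated_convergence
    (fun ω => 4 * (((N₁ t ω : ℝ) - N₁ s ω) + ((N₂ t ω : ℝ) - N₂ s ω))) (fun n => ?_)
    ((((hi₁ t).sub (hi₁ s)).add ((hi₂ t).sub (hi₂ s))).const_mul 4) (fun n => ?_) ?_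
  · exact (Finset.measurable_sum _ fun k _ =>
      measurable_multipleGoals h₁ h₂ _ _).aestronglyMeasurable
  · have A₁ : ∀ᵐ ω ∂P, ∀ k, N₁ (gridPoint s t (2 ^ n) k) ω ≤ N₁ (gridPoint s t (2 ^ n) (k + 1)) ω :=
      ae_all_iff.2 fun k => hm₁ _ _ (hle n k)
    have A₂ : ∀ᵐ ω ∂P, ∀ k, N₂ (gridPoint s t (2 ^ n) k) ω ≤ N₂ (gridPoint s t (2 ^ n) (k + 1)) ω :=
      ae_all_iff.2 fun k => hm₂ _ _ (hle n k)
    filter_upwards [A₁, A₂] with ω w₁ w₂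
    rw [Real.norm_of_nonneg (Finset.sum_nonneg fun k _ => multipleGoals_nonneg (w₁ k) (w₂ k))]
    refine (Finset.sum_le_sum fun k _ => multipleGoals_le (w₁ k) (w₂ k)).trans_eq ?_
    rw [← Finset.mul_sum, Finset.sum_add_distrib,
      Finset.sum_range_sub (fun k => (N₁ (gridPoint s t (2 ^ n) k) ω : ℝ)),
      Finset.sum_range_sub (fun k => (N₂ (gridPoint s t (2 ^ n) k) ω : ℝ)), gridPoint_zero,
      gridPoint_self s t (by positivity)]
  · filter_upwards [hj] with ω hω
    refine tendsto_const_nhds.congr' ?_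
    filter_upwards [hω] with n hn
    refine (Finset.sum_eq_zero fun k hk => ?_).symm
    rw [multipleGoals, if_pos (hn k (Finset.mem_range.1 hk))]

/-- A form of Watanabe's characterization of the Poisson process. -/
theorem integral_mul_goalChar_of_martingale [IsFiniteMeasure P]
    (ha₁ : ∀ t, Measurable[ℱ t] (N₁ t)) (ha₂ : ∀ t, Measurable[ℱ t] (N₂ t))
    (hM₁ : Martingale (assetPrice N₁ lam₁) ℱ P) (hM₂ : Martingale (assetPrice N₂ lam₂) ℱ P)
    (hm₁ : ∀ u v, u ≤ v → ∀ᵐ ω ∂P, N₁ u ω ≤ N₁ v ω)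
    (hm₂ : ∀ u v, u ≤ v → ∀ᵐ ω ∂P, N₂ u ω ≤ N₂ v ω) {s t : Set.Icc (0 : ℝ) T} (hst : s ≤ t)
    (hj : ∀ᵐ ω ∂P, ∀ᶠ n : ℕ in atTop, ∀ k < 2 ^ n,
      N₁ (gridPoint s t (2 ^ n) (k + 1)) ω + N₂ (gridPoint s t (2 ^ n) (k + 1)) ω ≤
        N₁ (gridPoint s t (2 ^ n) k) ω + N₂ (gridPoint s t (2 ^ n) k) ω + 1)
    {F : Ω → ℂ} (hF : Measurable[ℱ s] F) (hF1 : ∀ ω, ‖F ω‖ ≤ 1) (θ η : ℝ) :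
    ∫ ω, F ω * goalChar N₁ N₂ θ η t ω ∂P =
      Complex.exp (((t : ℝ) - s : ℝ) * poissonExponent lam₁ lam₂ θ η) *
        ∫ ω, F ω * goalChar N₁ N₂ θ η s ω ∂P := by
  have h₁ : ∀ t, Measurable (N₁ t) := fun t => (ha₁ t).mono (ℱ.le t) le_rfl
  have h₂ : ∀ t, Measurable (N₂ t) := fun t => (ha₂ t).mono (ℱ.le t) le_rfl
  have hi₁ := integrable_of_martingale_assetPrice hM₁
  have hi₂ := integrable_of_martingale_assetPrice hM₂
  have hd : 0 ≤ (t : ℝ) - s := sub_nonneg.2 hst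
  set K := poissonExponent lam₁ lam₂ θ η with hK
  set I : Set.Icc (0 : ℝ) T → ℂ := fun u => ∫ ω, F ω * goalChar N₁ N₂ θ η u ω ∂P with hI
  let q : ℕ → ℕ → Set.Icc (0 : ℝ) T := fun n k => gridPoint s t (2 ^ n) k
  let ε : ℕ → ℕ → ℝ := fun n k => ∫ ω, multipleGoals N₁ N₂ (q n k) (q n (k + 1)) ω ∂P
  have hle : ∀ n k, q n k ≤ q n (k + 1) := fun n k => monotone_gridPoint hst _ (Nat.le_succ k)
  have hε : ∀ n k, 0 ≤ ε n k := fun n k => by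
    refine integral_nonneg_of_ae ?_
    filter_upwards [hm₁ _ _ (hle n k), hm₂ _ _ (hle n k)] with ω w₁ w₂
    exact multipleGoals_nonneg w₁ w₂
  -- The one-step estimate is iterated over the `2 ^ n` grid intervals; the growth of the errors is
  -- at most `C ^ (2 ^ n)`, which the exponential bounds uniformly in `n`.
  have hbound : ∀ n : ℕ, ‖I t - (1 + (((t : ℝ) - s : ℝ) * K) / ((2 ^ n : ℕ) : ℂ)) ^ (2 ^ n) * I s‖ ≤
      Real.exp (((t : ℝ) - s) * ‖K‖) * ∑ k ∈ Finset.range (2 ^ n), ε n k := by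
    intro n
    set c : ℂ := 1 + (((t : ℝ) - s : ℝ) * K) / ((2 ^ n : ℕ) : ℂ) with hc
    set C : ℝ := 1 + ((t : ℝ) - s) * ‖K‖ / ((2 ^ n : ℕ) : ℝ) with hC
    have hC1 : 1 ≤ C := le_add_of_nonneg_right (by positivity)
    have hcC : ‖c‖ ≤ C := by
      refine (norm_add_le _ _).trans_eq ?_
      rw [norm_one, norm_div, norm_mul, Complex.norm_natCast, Complex.norm_real,
        Real.norm_of_nonneg hd]
    have hrec : ∀ k < 2 ^ n, ‖I (q n (k + 1)) - c * I (q n k)‖ ≤ ε n k := by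
      intro k hk
      have hsk : s ≤ q n k := by
        rw [← gridPoint_zero s t (2 ^ n)]
        exact monotone_gridPoint hst _ (Nat.zero_le k)
      have hstep := norm_integral_goalChar_step_le ha₁ ha₂ hM₁ hM₂ (hle n k) (hm₁ _ _ (hle n k))
        (hm₂ _ _ (hle n k)) (hF.mono (ℱ.mono hsk) le_rfl) hF1 θ η
      have hcoef : 1 + (((q n (k + 1) : ℝ) - q n k : ℝ) : ℂ) * K = c := by
        rw [gridPoint_succ_sub hst hk, hc]
        push_cast
        ring
      rw [← hK, hcoef] at hstep
      exact hstep
    have hfin := norm_sub_pow_mul_le_of_recursion (a := fun k => I (q n k)) hC1 hcC (hε n) hrec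
      (2 ^ n) le_rfl
    have hq0 : q n 0 = s := gridPoint_zero _ _ _
    have hqm : q n (2 ^ n) = t := gridPoint_self _ _ (by positivity)
    simp only [hq0, hqm] at hfin
    refine hfin.trans (mul_le_mul_of_nonneg_right ?_ (Finset.sum_nonneg fun k _ => hε n k))
    calc C ^ (2 ^ n) ≤ Real.exp (((t : ℝ) - s) * ‖K‖ / ((2 ^ n : ℕ) : ℝ)) ^ (2 ^ n) := by
          refine pow_le_pow_left₀ (by linarith) ?_ _
          rw [hC, add_comm]
          exact Real.add_one_le_exp _
      _ = Real.exp (((t : ℝ) - s) * ‖K‖) := by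
          rw [← Real.exp_nat_mul]
          congr 1
          field_simp
  have hlim₀ : Tendsto (fun n : ℕ => Real.exp (((t : ℝ) - s) * ‖K‖) *
      ∑ k ∈ Finset.range (2 ^ n), ε n k) atTop (𝓝 0) := by
    have := (tendsto_sum_integral_multipleGoals h₁ h₂ hi₁ hi₂ hm₁ hm₂ hst hj).const_mul
      (Real.exp (((t : ℝ) - s) * ‖K‖))
    rwa [mul_zero] at this
  have hlim₁ : Tendsto (fun n : ℕ => I t -
      (1 + (((t : ℝ) - s : ℝ) * K) / ((2 ^ n : ℕ) : ℂ)) ^ (2 ^ n) * I s) atTop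
      (𝓝 (I t - Complex.exp (((t : ℝ) - s : ℝ) * K) * I s)) := by
    have := (Complex.tendsto_one_add_div_pow_exp (((t : ℝ) - s : ℝ) * K)).comp
      (tendsto_pow_atTop_atTop_of_one_lt (r := 2) one_lt_two)
    exact tendsto_const_nhds.sub (this.mul_const _)
  have h0 := tendsto_nhds_unique hlim₁ (squeeze_zero_norm hbound hlim₀)
  exact sub_eq_zero.1 h0

end

/-! ### Finite-dimensional laws and uniqueness -/

section

variable {Ω : Type*} [mΩ : MeasurableSpace Ω] {T : ℝ}
  {N₁ N₂ : Set.Icc (0 : ℝ) T → Ω → ℕ} {P : Measure Ω}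

/-- The characteristic function of the vector `(N₁ u, N₂ u)`, `u ∈ J`. -/
noncomputable def jointGoalChar (N₁ N₂ : Set.Icc (0 : ℝ) T → Ω → ℕ) (J : Finset (Set.Icc (0 : ℝ) T))
    (θ η : Set.Icc (0 : ℝ) T → ℝ) (ω : Ω) : ℂ :=
  Complex.exp (((∑ u ∈ J, (θ u * N₁ u ω + η u * N₂ u ω) : ℝ) : ℂ) * Complex.I)

omit mΩ in
theorem jointGoalChar_insert {J : Finset (Set.Icc (0 : ℝ) T)} {a : Set.Icc (0 : ℝ) T} (ha : a ∉ J)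
    (θ η : Set.Icc (0 : ℝ) T → ℝ) (ω : Ω) : jointGoalChar N₁ N₂ (insert a J) θ η ω =
      jointGoalChar N₁ N₂ J θ η ω * goalChar N₁ N₂ (θ a) (η a) a ω := by
  rw [jointGoalChar, jointGoalChar, goalChar, ← Complex.exp_add, Finset.sum_insert ha]
  congr 1
  push_cast
  ring

omit mΩ in
theorem jointGoalChar_mul_goalChar {J : Finset (Set.Icc (0 : ℝ) T)} {a : Set.Icc (0 : ℝ) T}
    (ha : a ∈ J) (θ η : Set.Icc (0 : ℝ) T → ℝ) (x y : ℝ) (ω : Ω) :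
    jointGoalChar N₁ N₂ J θ η ω * goalChar N₁ N₂ x y a ω =
      jointGoalChar N₁ N₂ J (θ + Pi.single a x) (η + Pi.single a y) ω := by
  rw [jointGoalChar, jointGoalChar, goalChar, ← Complex.exp_add, ← add_mul, ← Complex.ofReal_add]
  congr 3
  simp only [Pi.add_apply, add_mul, Finset.sum_add_distrib, Pi.single_apply, ite_mul, zero_mul,
    Finset.sum_ite_eq', ha, if_true]
  ring

theorem measurable_jointGoalChar {J : Finset (Set.Icc (0 : ℝ) T)} {θ η : Set.Icc (0 : ℝ) T → ℝ}
    (h₁ : ∀ u ∈ J, Measurable (N₁ u)) (h₂ : ∀ u ∈ J, Measurable (N₂ u)) :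
    Measurable (jointGoalChar N₁ N₂ J θ η) := by
  have : Measurable fun ω => ∑ u ∈ J, (θ u * N₁ u ω + η u * N₂ u ω) := by
    refine Finset.measurable_sum _ fun u hu => ?_
    have := h₁ u hu
    have := h₂ u hu
    fun_prop
  unfold jointGoalChar
  fun_prop

variable {ℱ : Filtration (Set.Icc (0 : ℝ) T) mΩ} {lam₁ lam₂ : ℝ}

/-- Two laws under which the characteristic functions of the increments after `s`, given the past
up to `s`, are those of independent Poisson processes have the same finite-dimensional
characteristic functions. -/
theorem integral_jointGoalChar_eq {Q Q' : Measure Ω} [IsProbabilityMeasure Q]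
    [IsProbabilityMeasure Q'] {K : ℝ → ℝ → ℂ} (ha₁ : ∀ u v, u ≤ v → Measurable[ℱ v] (N₁ u))
    (ha₂ : ∀ u v, u ≤ v → Measurable[ℱ v] (N₂ u))
    (hz : ∀ S ∈ ({Q, Q'} : Set (Measure Ω)), ∀ u : Set.Icc (0 : ℝ) T, (u : ℝ) = 0 →
      ∀ᵐ ω ∂S, N₁ u ω = 0 ∧ N₂ u ω = 0)
    (h : ∀ S ∈ ({Q, Q'} : Set (Measure Ω)), ∀ s t : Set.Icc (0 : ℝ) T, s ≤ t → ∀ F : Ω → ℂ,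
      Measurable[ℱ s] F → (∀ ω, ‖F ω‖ ≤ 1) → ∀ θ η : ℝ,
      ∫ ω, F ω * goalChar N₁ N₂ θ η t ω ∂S = Complex.exp (((t : ℝ) - s : ℝ) * K θ η) *
        ∫ ω, F ω * goalChar N₁ N₂ θ η s ω ∂S) (J : Finset (Set.Icc (0 : ℝ) T)) :
    ∀ θ η : Set.Icc (0 : ℝ) T → ℝ,
      ∫ ω, jointGoalChar N₁ N₂ J θ η ω ∂Q = ∫ ω, jointGoalChar N₁ N₂ J θ η ω ∂Q' := by
  classical
  induction J using Finset.induction_on_max with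
  | empty =>
    intro θ η
    simp [jointGoalChar]
  | insert a J hJ ih =>
    intro θ η
    have haJ : a ∉ J := fun hmem => lt_irrefl _ (hJ a hmem)
    simp only [jointGoalChar_insert haJ]
    rcases J.eq_empty_or_nonempty with rfl | hne
    -- There is no earlier time in the set, so the comparison is with time `0`, where both processes
    -- vanish.
    · let z : Set.Icc (0 : ℝ) T := ⟨0, le_rfl, a.2.1.trans a.2.2⟩
      have key : ∀ S ∈ ({Q, Q'} : Set (Measure Ω)), IsProbabilityMeasure S →
          ∫ ω, jointGoalChar N₁ N₂ ∅ θ η ω * goalChar N₁ N₂ (θ a) (η a) a ω ∂S =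
            Complex.exp (((a : ℝ) - z : ℝ) * K (θ a) (η a)) := by
        intro S hS hSp
        have h1 := h S hS z a a.2.1 (fun _ => 1) measurable_const (by simp) (θ a) (η a)
        have h2 : ∫ ω, (1 : ℂ) * goalChar N₁ N₂ (θ a) (η a) z ω ∂S = ∫ ω, (1 : ℂ) ∂S := by
          refine integral_congr_ae ?_
          filter_upwards [hz S hS z rfl] with ω hω
          simp [goalChar, hω.1, hω.2]
        rw [h2] at h1
        simpa [jointGoalChar] using h1
      rw [key Q (by simp) inferInstance, key Q' (by simp) inferInstance]
    · have hmem := J.max'_mem hne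
      have hle : ∀ u ∈ J, u ≤ J.max' hne := fun u hu => J.le_max' u hu
      have hF : Measurable[ℱ (J.max' hne)] (jointGoalChar N₁ N₂ J θ η) :=
        measurable_jointGoalChar (mΩ := ℱ (J.max' hne)) (fun u hu => ha₁ _ _ (hle u hu))
          (fun u hu => ha₂ _ _ (hle u hu))
      have hF1 : ∀ ω, ‖jointGoalChar N₁ N₂ J θ η ω‖ ≤ 1 := fun ω =>
        (Complex.norm_exp_ofReal_mul_I _).le
      rw [h Q (by simp) _ a (hJ _ hmem).le _ hF hF1, h Q' (by simp) _ a (hJ _ hmem).le _ hF hF1]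
      -- The relation moves the factor at `a` back to the largest earlier time, where it merges into
      -- the frequencies; the induction hypothesis therefore has to cover all `θ` and `η`.
      simp only [jointGoalChar_mul_goalChar hmem]
      rw [ih]

/-- The path of the pair `(N₁, N₂)`, as a real valued function. -/
def goalPath (N₁ N₂ : Set.Icc (0 : ℝ) T → Ω → ℕ) (ω : Ω) (t : Set.Icc (0 : ℝ) T) : ℝ × ℝ :=
  (N₁ t ω, N₂ t ω)

theorem measurable_goalPath (h₁ : ∀ t, Measurable (N₁ t)) (h₂ : ∀ t, Measurable (N₂ t)) :
    Measurable (goalPath N₁ N₂) := by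
  refine measurable_pi_lambda _ fun t => ?_
  have := h₁ t
  have := h₂ t
  unfold goalPath
  fun_prop

/-- Characteristic functions determine the finite-dimensional laws, and a finite measure on the
product space is determined by these. -/
theorem map_goalPath_eq_of_jointGoalChar {Q Q' : Measure Ω} [IsProbabilityMeasure Q]
    [IsProbabilityMeasure Q'] (h₁ : ∀ t, Measurable (N₁ t)) (h₂ : ∀ t, Measurable (N₂ t))
    (h : ∀ (J : Finset (Set.Icc (0 : ℝ) T)) (θ η : Set.Icc (0 : ℝ) T → ℝ),
      ∫ ω, jointGoalChar N₁ N₂ J θ η ω ∂Q = ∫ ω, jointGoalChar N₁ N₂ J θ η ω ∂Q') :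
    Q.map (goalPath N₁ N₂) = Q'.map (goalPath N₁ N₂) := by
  classical
  have hp := measurable_goalPath h₁ h₂
  have key : ∀ J : Finset (Set.Icc (0 : ℝ) T),
      (Q.map (goalPath N₁ N₂)).map J.restrict = (Q'.map (goalPath N₁ N₂)).map J.restrict := by
    intro J
    have hr : Measurable (J.restrict (π := fun _ => ℝ × ℝ)) := Finset.measurable_restrict J
    have hpr : Measurable (J.restrict (π := fun _ => ℝ × ℝ) ∘ goalPath N₁ N₂) := hr.comp hp
    rw [Measure.map_map hr hp, Measure.map_map hr hp]
    have : IsProbabilityMeasure (Q.map (J.restrict (π := fun _ => ℝ × ℝ) ∘ goalPath N₁ N₂)) :=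
      Measure.isProbabilityMeasure_map hpr.aemeasurable
    have : IsProbabilityMeasure (Q'.map (J.restrict (π := fun _ => ℝ × ℝ) ∘ goalPath N₁ N₂)) :=
      Measure.isProbabilityMeasure_map hpr.aemeasurable
    refine Measure.ext_of_charFunDual (funext fun L => ?_)
    -- The frequencies are the coordinates of the dual vector `L` in the standard basis.
    let θ : Set.Icc (0 : ℝ) T → ℝ := fun u =>
      if hu : u ∈ J then L (Pi.single (⟨u, hu⟩ : J) ((1 : ℝ), (0 : ℝ))) else 0
    let η : Set.Icc (0 : ℝ) T → ℝ := fun u =>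
      if hu : u ∈ J then L (Pi.single (⟨u, hu⟩ : J) ((0 : ℝ), (1 : ℝ))) else 0
    have hL : ∀ ω, L ((J.restrict (π := fun _ => ℝ × ℝ) ∘ goalPath N₁ N₂) ω) =
        ∑ u ∈ J, (θ u * N₁ u ω + η u * N₂ u ω) := by
      intro ω
      rw [← Finset.univ_sum_single ((J.restrict (π := fun _ => ℝ × ℝ) ∘ goalPath N₁ N₂) ω),
        map_sum, ← Finset.sum_coe_sort J]
      refine Finset.sum_congr rfl fun u _ => ?_
      have hu : ((J.restrict (π := fun _ => ℝ × ℝ) ∘ goalPath N₁ N₂) ω) u =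
          (N₁ u ω : ℝ) • ((1 : ℝ), (0 : ℝ)) + (N₂ u ω : ℝ) • ((0 : ℝ), (1 : ℝ)) := by
        simp [goalPath]
      rw [hu, Pi.single_add, Pi.single_smul, Pi.single_smul, map_add, map_smul, map_smul]
      simp only [θ, η, u.2, dif_pos, smul_eq_mul]
      ring
    have hc : ∀ S : Measure Ω,
        charFunDual (S.map (J.restrict (π := fun _ => ℝ × ℝ) ∘ goalPath N₁ N₂)) L =
          ∫ ω, jointGoalChar N₁ N₂ J θ η ω ∂S := by
      intro S
      rw [charFunDual_apply, integral_map hpr.aemeasurable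
        (by fun_prop : Measurable _).aestronglyMeasurable]
      simp only [hL, jointGoalChar]
    rw [hc, hc, h]
  have : IsProbabilityMeasure (Q.map (goalPath N₁ N₂)) :=
    Measure.isProbabilityMeasure_map hp.aemeasurable
  have : ∀ J : Finset (Set.Icc (0 : ℝ) T),
      IsFiniteMeasure ((Q.map (goalPath N₁ N₂)).map (J.restrict (π := fun _ => ℝ × ℝ))) :=
    fun J => inferInstance
  exact IsProjectiveLimit.unique
    (P := fun J : Finset (Set.Icc (0 : ℝ) T) =>
      (Q.map (goalPath N₁ N₂)).map (J.restrict (π := fun _ => ℝ × ℝ)))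
    (fun J => rfl) fun J => (key J).symm

theorem measure_eq_of_isMartingaleMeasure {Q Q' : Measure Ω} [IsProbabilityMeasure Q]
    [IsProbabilityMeasure Q'] (h₁ : ∀ t, Measurable (N₁ t)) (h₂ : ∀ t, Measurable (N₂ t))
    (hQR : ∀ S ∈ ({Q, Q'} : Set (Measure Ω)),
      IsMartingaleMeasure (goalFiltration N₁ N₂ h₁ h₂) N₁ N₂ lam₁ lam₂ S ∧
      (∀ u : Set.Icc (0 : ℝ) T, (u : ℝ) = 0 → ∀ᵐ ω ∂S, N₁ u ω = 0 ∧ N₂ u ω = 0) ∧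
      (∀ u v, u ≤ v → ∀ᵐ ω ∂S, N₁ u ω ≤ N₁ v ω ∧ N₂ u ω ≤ N₂ v ω) ∧
      ∀ s t, s ≤ t → ∀ᵐ ω ∂S, ∀ᶠ n : ℕ in atTop, ∀ k < 2 ^ n,
      N₁ (gridPoint s t (2 ^ n) (k + 1)) ω + N₂ (gridPoint s t (2 ^ n) (k + 1)) ω ≤
        N₁ (gridPoint s t (2 ^ n) k) ω + N₂ (gridPoint s t (2 ^ n) k) ω + 1)
    (t : Set.Icc (0 : ℝ) T) {A : Set Ω} (hA : MeasurableSet[goalFiltration N₁ N₂ h₁ h₂ t] A) :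
    Q A = Q' A := by
  have hS : ∀ S ∈ ({Q, Q'} : Set (Measure Ω)), IsProbabilityMeasure S := by
    rintro S (rfl | rfl) <;> assumption
  have hchar := integral_jointGoalChar_eq (Q := Q) (Q' := Q') (K := poissonExponent lam₁ lam₂)
    (fun u v huv => measurable_goalFiltration_left h₁ h₂ huv)
    (fun u v huv => measurable_goalFiltration_right h₁ h₂ huv)
    (fun S hSm => (hQR S hSm).2.1) (fun S hSm s t hst F hF hF1 θ η => by
      have := hS S hSm
      obtain ⟨⟨-, hM₁, hM₂⟩, -, hm, hj⟩ := hQR S hSm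
      exact integral_mul_goalChar_of_martingale
        (fun t => measurable_goalFiltration_left h₁ h₂ le_rfl)
        (fun t => measurable_goalFiltration_right h₁ h₂ le_rfl) hM₁ hM₂
        (fun u v huv => (hm u v huv).mono fun ω hω => hω.1)
        (fun u v huv => (hm u v huv).mono fun ω hω => hω.2) hst (hj s t hst) hF hF1 θ η)
  have hmap := map_goalPath_eq_of_jointGoalChar h₁ h₂ hchar
  have hle : goalFiltration N₁ N₂ h₁ h₂ t ≤ MeasurableSpace.comap (goalPath N₁ N₂) inferInstance :=
    goalFiltration_le_comap h₁ h₂ t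
      (fun u _ => ⟨fun f => ⌊(f u).1⌋₊, by fun_prop, by funext ω; simp [goalPath]⟩)
      (fun u _ => ⟨fun f => ⌊(f u).2⌋₊, by fun_prop, by funext ω; simp [goalPath]⟩)
  obtain ⟨C, hC, rfl⟩ := hle A hA
  have hp := measurable_goalPath h₁ h₂
  rw [← Measure.map_apply hp hC, ← Measure.map_apply hp hC, hmap]

/-- Almost sure events of a sub-`σ`-algebra are inherited by measures whose null sets there are the
same. -/
theorem ae_of_measure_eq_zero_iff {Q : Measure Ω} {m : MeasurableSpace Ω}
    (h : ∀ A : Set Ω, MeasurableSet[m] A → (Q A = 0 ↔ P A = 0)) {p : Ω → Prop}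
    (hp : MeasurableSet[m] {ω | p ω}) (hP : ∀ᵐ ω ∂P, p ω) : ∀ᵐ ω ∂Q, p ω :=
  (h _ hp.compl).2 hP

end

/-! ### The risk-neutral measure -/

theorem mainTheorem1 {Ω : Type*} [mΩ : MeasurableSpace Ω]
    (P : Measure Ω) [IsProbabilityMeasure P]
    (T : ℝ) (hT : 0 < T)
    (mu₁ mu₂ lam₁ lam₂ : ℝ)
    (hmu₁ : 0 < mu₁) (hmu₂ : 0 < mu₂) (hlam₁ : 0 < lam₁) (hlam₂ : 0 < lam₂)
    (N₁ N₂ : Set.Icc (0 : ℝ) T → Ω → ℕ)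
    (hN₁ : IsPoissonProcess N₁ mu₁ P) (hN₂ : IsPoissonProcess N₂ mu₂ P)
    (hN : IndepFun (fun ω t => N₁ t ω) (fun ω t => N₂ t ω) P)
    (ℱ : Filtration (Set.Icc (0 : ℝ) T) mΩ)
    (hℱ : ℱ = goalFiltration N₁ N₂ hN₁.measurable hN₂.measurable) :
    ∃ Q : Measure Ω, IsProbabilityMeasure Q ∧
      -- (a) the asset prices are martingales
      IsMartingaleMeasure ℱ N₁ N₂ lam₁ lam₂ Q ∧
      -- (b) the goal processes are (independent) Poisson processes
      IsPoissonProcess N₁ lam₁ Q ∧ IsPoissonProcess N₂ lam₂ Q ∧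
      IndepFun (fun ω t => N₁ t ω) (fun ω t => N₂ t ω) Q ∧
      -- (c) equivalence
      Q ≪ P ∧ P ≪ Q ∧
      -- (d) uniqueness, on the events up to the end of the game
      ∀ Q' : Measure Ω, IsProbabilityMeasure Q' →
        IsMartingaleMeasure ℱ N₁ N₂ lam₁ lam₂ Q' →
        (∀ A : Set Ω, MeasurableSet[ℱ ⟨T, hT.le, le_rfl⟩] A → (Q' A = 0 ↔ P A = 0)) →
        ∀ A : Set Ω, MeasurableSet[ℱ ⟨T, hT.le, le_rfl⟩] A → Q' A = Q A := by
  obtain ⟨Q, hQp, hQ₁, hQ₂, hQind, hQP, hPQ⟩ :=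
    exists_equivalent_measure_isPoissonProcess hT.le hmu₁ hmu₂ hlam₁ hlam₂ hN₁ hN₂ hN
  have hQM := isMartingaleMeasure_of_isPoissonProcess hlam₁.le hlam₂.le hQ₁ hQ₂ hQind
  subst hℱ
  refine ⟨Q, hQp, hQM, hQ₁, hQ₂, hQind, hQP, hPQ, fun Q' hQ'p hQ'M hnull A hA => ?_⟩
  have h₁ := hN₁.measurable
  have h₂ := hN₂.measurable
  have hz : ∀ u : Set.Icc (0 : ℝ) T, (u : ℝ) = 0 → ∀ᵐ ω ∂P, N₁ u ω = 0 ∧ N₂ u ω = 0 := fun u hu =>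
    (hN₁.start_zero u hu).and (hN₂.start_zero u hu)
  -- Monotonicity is recorded for fixed pairs of times: such an event lies in the terminal
  -- `σ`-algebra and so passes to `Q'`, whereas monotonicity of the whole path involves uncountably
  -- many times.
  have hm : ∀ u v, u ≤ v → ∀ᵐ ω ∂P, N₁ u ω ≤ N₁ v ω ∧ N₂ u ω ≤ N₂ v ω := fun u v huv => by
    filter_upwards [hN₁.monotone_paths, hN₂.monotone_paths] with ω w₁ w₂
    exact ⟨w₁ huv, w₂ huv⟩
  have hj : ∀ s t : Set.Icc (0 : ℝ) T, s ≤ t → _ := fun s t hst =>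
    ae_eventually_grid_increment_le_one hmu₁.le hmu₂.le hN₁ hN₂ hN hst
  have a₁ : ∀ u, Measurable[goalFiltration N₁ N₂ h₁ h₂ ⟨T, hT.le, le_rfl⟩] (N₁ u) := fun u =>
    measurable_goalFiltration_left h₁ h₂ u.2.2
  have a₂ : ∀ u, Measurable[goalFiltration N₁ N₂ h₁ h₂ ⟨T, hT.le, le_rfl⟩] (N₂ u) := fun u =>
    measurable_goalFiltration_right h₁ h₂ u.2.2
  refine measure_eq_of_isMartingaleMeasure (lam₁ := lam₁) (lam₂ := lam₂) h₁ h₂ ?_ _ hA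
  rintro S (rfl | rfl)
  · refine ⟨hQ'M, fun u hu => ?_, fun u v huv => ?_, fun s t hst => ?_⟩
    · exact ae_of_measure_eq_zero_iff hnull (MeasurableSet.inter
        (a₁ u (measurableSet_singleton 0)) (a₂ u (measurableSet_singleton 0))) (hz u hu)
    · exact ae_of_measure_eq_zero_iff hnull (MeasurableSet.inter
        (measurableSet_le (a₁ u) (a₁ v)) (measurableSet_le (a₂ u) (a₂ v))) (hm u v huv)
    · exact ae_of_measure_eq_zero_iff hnull
        (measurableSet_eventually_grid_increment_le_one
          (mΩ := goalFiltration N₁ N₂ h₁ h₂ ⟨T, hT.le, le_rfl⟩) a₁ a₂ s t) (hj s t hst)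
  · exact ⟨hQM, fun u hu => hQP.ae_le (hz u hu), fun u v huv => hQP.ae_le (hm u v huv),
      fun s t hst => hQP.ae_le (hj s t hst)⟩
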